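/- Let $H$ be a real separable Hilbert space and let $\Psi$ be a bounded linear operator on $H$ with $\|\Psi\|_{\mathcal L}<1$; all random elements are defined on one probability space $(\Omega,\mathcal A,P)$. For $x,y\in H$ let $(x\otimes y)(v)=\langle x,v\rangle y$. Elements $X,Y\in L^2_H$ are orthogonal, $X\perp Y$, if $E[X\otimes Y]=0$; an $H$-white noise is a sequence of pairwise orthogonal elements of $L^2_H$ with constant mean and constant covariance operator $E[(X-EX)\otimes(X-EX)]$. A sequence $(X_n)_{n\ge1}$ in $L^4_H$ is $L^4$-$m$-approximable if $X_n=f(\delta_n,\delta_{n-1},\dots)$ a.s. for all $n\ge 1$, with i.i.d. $(\delta_i)_{i\in\mathbb Z}$ in a measurable space $S$ and a measurable $f:S^\infty\to H$, and $\sum_{m\ge1}\bigl(E\|X_m-X_m^{(m)}\|^4\bigr)^{1/4}<\infty$, where $X_m^{(m)}=f(\delta_m,\dots,\delta_1,\delta_0',\delta_{-1}',\dots)$ and $(\delta'_i)$ is an independent copy of $(\delta_i)$. Consider the recursion $X_{n+1}=\Psi(X_n)+\varepsilon_{n+1}$ a.s. It is the linear model $Y_k=\Psi(X_k)+\eta_k$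 with responses $Y_k=X_{k+1}$ and errors $\eta_k=\varepsilon_{k+1}$, $k\ge 1$. Assumption (A) says: $(X_k)_{k\ge1}$ and $(\eta_k)_{k\ge1}$ have mean zero and are $L^4$-$m$-approximable, $(\eta_k)_{k\ge1}$ is $H$-white noise, and $X_k\perp\eta_k$ for all $k\ge1$. (1) Let $(X_n)_{n\ge1}$ satisfy the recursion for all $n\ge1$ and let Assumption (A) hold. Let $m_n\to\infty$ be real numbers with $m_n=o(\sqrt n)$. Put $\hat C_n=\frac1n\sum_{k=1}^nX_k\otimes X_k$ and $\hat\Delta_n=\frac1n\sum_{k=1}^nX_k\otimes X_{k+1}$, let $\hat\lambda_1\ge\hat\lambda_2\ge\dots\ge0$ be the eigenvalues of $\hat C_n$ with multiplicity and $\hat v_1,\hat v_2,\dots$ corresponding orthonormal eigenvectors, and let $K_n=\max\{j\ge1:\hat\lambda_1/\hat\lambda_j\le m_n\}$, where a quotient with $\hat\lambda_j=0$ counts as $\infty$ and $K_n=0$ if there is no such $j$. Then, for any choice of the eigenvectors, the estimator $$\hat\Psi_{K_n}(x)=\sum_{j=1}^{K_n}\frac{\hat\Delta_n(\hat v_j)}{\hat\lambda_j}\langle\hat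 v_j,x\rangle$$ satisfies $\|\Psi(X_n)-\hat\Psi_{K_n}(X_n)\|\to0$ in probability as $n\to\infty$. (2) Let $(X_n)_{n\in\mathbb Z}$ be a strictly stationary process satisfying the recursion for all $n\in\mathbb Z$, where $(\varepsilon_i)_{i\in\mathbb Z}$ are i.i.d. in $L^4_H$ with mean zero. Then Assumption (A) holds. -/

import Mathlib

open MeasureTheory ProbabilityTheory Filter Topology

universe u

noncomputable section

namespace FunctionalRegression

section Operators

variable {H₁ H₂ : Type*} [NormedAddCommGroup H₁] [InnerProductSpace ℝ H₁]
  [NormedAddCommGroup H₂] [InnerProductSpace ℝ H₂]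

/-- The operator `x ⊗ y : H₁ → H₂`, `(x ⊗ y)(v) = ⟨x, v⟩ y`. -/
def tensor (x : H₁) (y : H₂) : H₁ →L[ℝ] H₂ := InnerProductSpace.rankOne ℝ y x

theorem tensor_apply (x v : H₁) (y : H₂) : tensor x y v = inner ℝ x v • y := rfl

end Operators

section Probability

variable {Ω : Type*} [MeasurableSpace Ω]

/-- The elements `X` and `Y` of `L²` are orthogonal: `E[X ⊗ Y] = 0`. -/
def Orthogonal {H₁ H₂ : Type*} [NormedAddCommGroup H₁] [InnerProductSpace ℝ H₁]
    [NormedAddCommGroup H₂] [InnerProductSpace ℝ H₂]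
    (P : Measure Ω) (X : Ω → H₁) (Y : Ω → H₂) : Prop :=
  MemLp X 2 P ∧ MemLp Y 2 P ∧ ∫ ω, tensor (X ω) (Y ω) ∂P = 0

/-- The covariance operator `E[(X - EX) ⊗ (X - EX)]`. -/
def covOperator {H : Type*} [NormedAddCommGroup H] [InnerProductSpace ℝ H]
    (P : Measure Ω) (X : Ω → H) : H →L[ℝ] H :=
  ∫ ω, tensor (X ω - ∫ ω', X ω' ∂P) (X ω - ∫ ω', X ω' ∂P) ∂P

/-- `(ε k)`, `k ≥ 1`, is an `H`-white noise: square integrable, pairwise orthogonal, with constant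
mean and constant covariance operator. -/
structure IsWhiteNoise {H : Type*} [NormedAddCommGroup H] [InnerProductSpace ℝ H]
    (P : Measure Ω) (ε : ℕ → Ω → H) : Prop where
  memLp : ∀ k, 1 ≤ k → MemLp (ε k) 2 P
  orthogonal : ∀ j k, 1 ≤ j → 1 ≤ k → j ≠ k → Orthogonal P (ε j) (ε k)
  mean_const : ∀ j k, 1 ≤ j → 1 ≤ k → ∫ ω, ε j ω ∂P = ∫ ω, ε k ω ∂P
  cov_const : ∀ j k, 1 ≤ j → 1 ≤ k → covOperator P (ε j) = covOperator P (ε k)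

/-- The number `ν_p(X_m - X_m^{(m)})` for `X_m = f(δ_m, δ_{m-1}, …)`, where
`X_m^{(m)} = f(δ_m, …, δ_1, δ'_0, δ'_{-1}, …)`. The independent copy `δ'` of `δ` is realized on the
product space: `δ` is read off the first coordinate and `δ'` off the second one. -/
def couplingError {S H : Type*} [NormedAddCommGroup H]
    (P : Measure Ω) (p : ENNReal) (δ : ℤ → Ω → S) (f : (ℕ → S) → H) (m : ℕ) : ENNReal :=
  eLpNorm (fun q : Ω × Ω =>
    f (fun j : ℕ => δ ((m : ℤ) - j) q.1) -
      f (fun j : ℕ => if j < m then δ ((m : ℤ) - j) q.1 else δ ((m : ℤ) - j) q.2)) p (P.prod P)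

/-- `L^p`-`m`-approximability of the sequence `(X n)`, `n ≥ 1`: the `X n` have `p` moments,
`X n = f(δ_n, δ_{n-1}, …)` almost surely with `f` measurable and `(δ_i)` i.i.d., and
`∑_{m ≥ 1} ν_p(X_m - X_m^{(m)}) < ∞`. -/
def IsLpMApproximable {H : Type u} [NormedAddCommGroup H] [MeasurableSpace H]
    (P : Measure Ω) (p : ENNReal) (X : ℕ → Ω → H) : Prop :=
  (∀ n, 1 ≤ n → MemLp (X n) p P) ∧
  ∃ (S : Type u) (_ : MeasurableSpace S) (δ : ℤ → Ω → S) (f : (ℕ → S) → H),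
    (∀ i, Measurable (δ i)) ∧ iIndepFun δ P ∧ (∀ i, IdentDistrib (δ i) (δ 0) P P) ∧
    Measurable f ∧
    (∀ n : ℕ, 1 ≤ n → X n =ᵐ[P] fun ω => f (fun j : ℕ => δ ((n : ℤ) - j) ω)) ∧
    ∑' m : ℕ, couplingError P p δ f (m + 1) ≠ ⊤

/-- Assumption (A) on the regressors `X k` and the errors `ε k`, `k ≥ 1`, of the linear model
`Y k = Ψ (X k) + ε k` with `Ψ : H₁ →L[ℝ] H₂`. -/
structure AssumptionA {H₁ H₂ : Type*} [NormedAddCommGroup H₁] [InnerProductSpace ℝ H₁]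
    [MeasurableSpace H₁] [NormedAddCommGroup H₂] [InnerProductSpace ℝ H₂] [MeasurableSpace H₂]
    (P : Measure Ω) (X : ℕ → Ω → H₁) (ε : ℕ → Ω → H₂) : Prop where
  mean_X : ∀ k, 1 ≤ k → ∫ ω, X k ω ∂P = 0
  mean_ε : ∀ k, 1 ≤ k → ∫ ω, ε k ω ∂P = 0
  approx_X : IsLpMApproximable P 4 X
  approx_ε : IsLpMApproximable P 4 ε
  whiteNoise : IsWhiteNoise P ε
  orthogonal : ∀ k, 1 ≤ k → Orthogonal P (X k) (ε k)

/-- A (two-sided) stationary ARH(1) process with operator `Ψ` and innovations `ε`. -/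
structure IsStationaryARH1 {H : Type*} [NormedAddCommGroup H] [InnerProductSpace ℝ H]
    [MeasurableSpace H] (P : Measure Ω) (Ψ : H →L[ℝ] H) (X ε : ℤ → Ω → H) : Prop where
  aemeasurable : ∀ k, AEMeasurable (X k) P
  stationary : ∀ h : ℤ, P.map (fun ω k => X (k + h) ω) = P.map (fun ω k => X k ω)
  recurrence : ∀ k, ∀ᵐ ω ∂P, X (k + 1) ω = Ψ (X k ω) + ε (k + 1) ω

end Probability

section Estimator

variable {H₁ H₂ : Type*} [NormedAddCommGroup H₁] [InnerProductSpace ℝ H₁]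
  [NormedAddCommGroup H₂] [InnerProductSpace ℝ H₂]

/-- The empirical operator `(1/n) ∑_{k=1}^n x_k ⊗ y_k`. For `y = x` it is `Ĉ_n`, and for the
responses `y` it is `Δ̂_n`. -/
def empiricalOperator (n : ℕ) (x : ℕ → H₁) (y : ℕ → H₂) : H₁ →L[ℝ] H₂ :=
  (n : ℝ)⁻¹ • ∑ k ∈ Finset.Icc 1 n, tensor (x k) (y k)

/-- `(lam j, v j)`, `j ≥ 1`, are the eigenvalues, in decreasing order and with multiplicity, and
orthonormal eigenvectors of the positive operator `T`: `T = ∑_j lam_j v_j ⊗ v_j`.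
The `v j` with `lam j = 0` play no role and are left free. -/
structure IsEigensystem (T : H₁ →L[ℝ] H₁) (lam : ℕ → ℝ) (v : ℕ → H₁) : Prop where
  nonneg : ∀ j, 1 ≤ j → 0 ≤ lam j
  antitone : ∀ i j, 1 ≤ i → i ≤ j → lam j ≤ lam i
  orthonormal : Orthonormal ℝ (fun j : {j : ℕ // 1 ≤ j ∧ lam j ≠ 0} => v j)
  hasSum : ∀ x, HasSum (fun j : ℕ => lam (j + 1) • tensor (v (j + 1)) (v (j + 1)) x) (T x)

/-- `K_n = argmax {j ≥ 1 | λ̂_1 / λ̂_j ≤ m_n}`, where a quotient with `λ̂_j = 0` counts as `∞`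
(so `j ≤ n`, since `Ĉ_n` has rank at most `n`). It is `0` if there is no such `j`. -/
def truncationLevel (n : ℕ) (mn : ℝ) (lam : ℕ → ℝ) : ℕ :=
  sSup {j : ℕ | 1 ≤ j ∧ j ≤ n ∧ 0 < lam j ∧ lam 1 / lam j ≤ mn}

/-- The principal component estimator `Ψ̂_K(z) = ∑_{j=1}^K (⟨v̂_j, z⟩ / λ̂_j) Δ̂_n(v̂_j)` computed
from the sample `(x_k, y_k)`, `1 ≤ k ≤ n`, and an eigensystem `(lam, v)` of `Ĉ_n`. -/
def pcEstimator (n K : ℕ) (x : ℕ → H₁) (y : ℕ → H₂) (lam : ℕ → ℝ) (v : ℕ → H₁) (z : H₁) : H₂ :=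
  ∑ j ∈ Finset.Icc 1 K, (inner ℝ (v j) z / lam j) • empiricalOperator n x y (v j)

end Estimator

end FunctionalRegression

end

/-! Prediction. Let `T` be the empirical covariance operator, `C` the true one, and `g = ∑_{j ≤ K}
(⟨v_j, z⟩ / λ_j) v_j`. Then `T g` is the projection of `z` onto the first `K` eigenvectors, so the
error at `z` is `Ψ (z - T g)` minus the noise operator `(1/n) ∑ x_k ⊗ e_k` applied to `g`. The noise
operator is of order `n^{-1/2}` in mean square and `‖g‖ ≤ (m / λ_1) ‖z‖`, so `m = o(√n)` makes this
term negligible once `λ_1` is bounded below. The projection term needs neither spectral gaps nor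
convergence of eigenvectors: compare `z` with `C d`, then `C d` with `T d`; projecting `T d` loses
only components with `λ_j < λ_1 / m` (`IsEigensystem.norm_sub_pcEstimator_le`). Suitable `d` exist
because `X_n` lies almost surely in the closure of the range of `C` (`ae_mem_closure_range`), and
finitely many `d` serve all `n` with high probability because the `X_n` share one law. The moment
bounds come from coupling (`IsIID.exists_integral_norm_sq_sum_le`): the coupled copy of the `m`-th
term is independent of the `0`-th, so the covariance at lag `m` is at most a multiple of the
coupling error, which is summable. This is applied to tensors built from `X_k` and from `e_k =
X_{k+1} - Ψ X_k`, both functions of one driving sequence. Autoregression. Iterating the recursion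
gives a difference `Ψ^n (X_{k-n} - Y_{k-n})` between the stationary solution and the causal series
`Y`; as laws do not depend on time, it vanishes (`IsIID.ae_eq_causalSeries`). The series has
geometrically decaying coupling errors, and its value at `k` is independent of the next innovation.
-/

noncomputable section

namespace FunctionalRegression

/-! ### Laws of pasts and coupled pasts of an i.i.d. sequence -/

section IID

variable {Ω : Type*} [MeasurableSpace Ω] {P : Measure Ω} {S : Type*} [MeasurableSpace S]

/-- An i.i.d. sequence indexed by the integers. -/
structure IsIID (P : Measure Ω) (δ : ℤ → Ω → S) : Prop where
  measurable : ∀ i, Measurable (δ i)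
  indep : iIndepFun δ P
  identDistrib : ∀ i, IdentDistrib (δ i) (δ 0) P P

/-- The past `(δ_k, δ_{k-1}, …)` of a sequence. -/
def past (δ : ℤ → Ω → S) (k : ℤ) (ω : Ω) : ℕ → S := fun j => δ (k - j) ω

/-- The sequence `(δ_m, …, δ_1, δ'_0, δ'_{-1}, …)`. -/
def coupledPast (δ : ℤ → Ω → S) (m : ℕ) (q : Ω × Ω) : ℕ → S :=
  fun j => if j < m then δ ((m : ℤ) - j) q.1 else δ ((m : ℤ) - j) q.2

/-- Two independent copies of a sequence, as one family on the product space. -/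
def twoCopies (δ : ℤ → Ω → S) : ℤ ⊕ ℤ → Ω × Ω → S :=
  Sum.elim (fun i q => δ i q.1) (fun i q => δ i q.2)

/-- Both laws are the same infinite product measure. The distributional identities for pasts and
coupled pasts below reduce to choosing two injections of indices. -/
theorem map_reindex_eq {ι κ : Type*} {D : κ → Ω → S} {ν : Measure S} (hm : ∀ i, Measurable (D i))
    (hi : iIndepFun D P) (hd : ∀ i, P.map (D i) = ν) {φ ψ : ι → κ} (hφ : φ.Injective)
    (hψ : ψ.Injective) :
    P.map (fun ω i => D (φ i) ω) = P.map (fun ω i => D (ψ i) ω) := by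
  rw [(hi.precomp hφ).map_fun_eq_infinitePi_map (fun i => hm _),
    (hi.precomp hψ).map_fun_eq_infinitePi_map (fun i => hm _)]
  simp [hd]

variable {δ : ℤ → Ω → S}

theorem measurable_past (hm : ∀ i, Measurable (δ i)) (k : ℤ) : Measurable (past δ k) :=
  measurable_pi_lambda _ fun _ => hm _

theorem measurable_coupledPast (hm : ∀ i, Measurable (δ i)) (m : ℕ) :
    Measurable (coupledPast δ m) := by
  refine measurable_pi_lambda _ fun j => ?_
  by_cases h : j < m
  · simpa [coupledPast, h, Function.comp_def] using (hm ((m : ℤ) - j)).comp measurable_fst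
  · simpa [coupledPast, h, Function.comp_def] using (hm ((m : ℤ) - j)).comp measurable_snd

theorem measurable_twoCopies (hm : ∀ i, Measurable (δ i)) (i : ℤ ⊕ ℤ) :
    Measurable (twoCopies δ i) := by
  rcases i with i | i
  · exact (hm i).comp measurable_fst
  · exact (hm i).comp measurable_snd

theorem IsIID.identDistrib_past (h : IsIID P δ) (k l : ℤ) :
    IdentDistrib (past δ k) (past δ l) P P where
  aemeasurable_fst := (measurable_past h.measurable k).aemeasurable
  aemeasurable_snd := (measurable_past h.measurable l).aemeasurable
  map_eq := map_reindex_eq (φ := fun j : ℕ => k - j) (ψ := fun j : ℕ => l - j) h.measurable h.indep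
    (fun i => (h.identDistrib i).map_eq) (fun a b hab => by simpa using hab)
    (fun a b hab => by simpa using hab)

variable [IsProbabilityMeasure P]

theorem IsIID.map_twoCopies (h : IsIID P δ) (i : ℤ ⊕ ℤ) :
    (P.prod P).map (twoCopies δ i) = P.map (δ 0) := by
  rcases i with i | i
  · rw [← (h.identDistrib i).map_eq]
    change (P.prod P).map (δ i ∘ Prod.fst) = _
    rw [← Measure.map_map (h.measurable i) measurable_fst]
    simp
  · rw [← (h.identDistrib i).map_eq]
    change (P.prod P).map (δ i ∘ Prod.snd) = _
    rw [← Measure.map_map (h.measurable i) measurable_snd]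
    simp

/-- A finite cylinder event is a rectangle, one side for each copy, so its product measure factors.
-/
theorem IsIID.iIndepFun_twoCopies (h : IsIID P δ) : iIndepFun (twoCopies δ) (P.prod P) := by
  classical
  rw [iIndepFun_iff_measure_inter_preimage_eq_mul]
  intro s A hA
  have hs : (⋂ i ∈ s, twoCopies δ i ⁻¹' A i)
      = (⋂ i ∈ s.toLeft, δ i ⁻¹' A (Sum.inl i)) ×ˢ (⋂ i ∈ s.toRight, δ i ⁻¹' A (Sum.inr i)) := by
    ext q
    simp [twoCopies, Sum.forall]
  have hprod : ∏ i ∈ s, (P.prod P) (twoCopies δ i ⁻¹' A i)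
      = (∏ i ∈ s.toLeft, (P.prod P) (twoCopies δ (Sum.inl i) ⁻¹' A (Sum.inl i)))
        * ∏ i ∈ s.toRight, (P.prod P) (twoCopies δ (Sum.inr i) ⁻¹' A (Sum.inr i)) := by
    conv_lhs => rw [← Finset.toLeft_disjSum_toRight (u := s)]
    rw [Finset.prod_disjSum]
  have hl : ∀ i, (P.prod P) (twoCopies δ (Sum.inl i) ⁻¹' A (Sum.inl i))
      = P (δ i ⁻¹' A (Sum.inl i)) := by
    intro i
    have : twoCopies δ (Sum.inl i) ⁻¹' A (Sum.inl i) = (δ i ⁻¹' A (Sum.inl i)) ×ˢ Set.univ := by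
      ext q; simp [twoCopies]
    rw [this, Measure.prod_prod]; simp
  have hr : ∀ i, (P.prod P) (twoCopies δ (Sum.inr i) ⁻¹' A (Sum.inr i))
      = P (δ i ⁻¹' A (Sum.inr i)) := by
    intro i
    have : twoCopies δ (Sum.inr i) ⁻¹' A (Sum.inr i) = Set.univ ×ˢ (δ i ⁻¹' A (Sum.inr i)) := by
      ext q; simp [twoCopies]
    rw [this, Measure.prod_prod]; simp
  rw [hs, hprod, Measure.prod_prod]
  simp_rw [hl, hr]
  rw [h.indep.measure_inter_preimage_eq_mul _ (fun i hi => hA _ (by simpa using hi)),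
    h.indep.measure_inter_preimage_eq_mul _ (fun i hi => hA _ (by simpa using hi))]

theorem IsIID.identDistrib_coupledPast (h : IsIID P δ) (m : ℕ) :
    IdentDistrib (coupledPast δ m) (past δ 0) (P.prod P) P where
  aemeasurable_fst := (measurable_coupledPast h.measurable m).aemeasurable
  aemeasurable_snd := (measurable_past h.measurable 0).aemeasurable
  map_eq := by
    have h1 := map_reindex_eq (P := P.prod P) (D := twoCopies δ) (ν := P.map (δ 0))
      (φ := fun j : ℕ => if j < m then Sum.inl ((m : ℤ) - j) else Sum.inr ((m : ℤ) - j))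
      (ψ := fun j : ℕ => Sum.inl (0 - (j : ℤ)))
      (measurable_twoCopies h.measurable) h.iIndepFun_twoCopies h.map_twoCopies
      (fun a b hab => by
        by_cases ha : a < m <;> by_cases hb : b < m <;> simp_all)
      (fun a b hab => by simpa using hab)
    have h2 : (fun (q : Ω × Ω) (j : ℕ) => twoCopies δ
        (if j < m then Sum.inl ((m : ℤ) - j) else Sum.inr ((m : ℤ) - j)) q) = coupledPast δ m := by
      funext q j
      by_cases hj : j < m <;> simp [twoCopies, coupledPast, hj]
    rw [h2] at h1
    rw [h1]
    change (P.prod P).map (past δ 0 ∘ Prod.fst) = _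
    rw [← Measure.map_map (measurable_past h.measurable 0) measurable_fst]
    simp

/-- `(δ_0, δ_{-1}, …)` and `(δ_m, …, δ_1, δ'_0, δ'_{-1}, …)` are independent. -/
theorem IsIID.identDistrib_past_coupledPast (h : IsIID P δ) (m : ℕ) :
    IdentDistrib (fun q : Ω × Ω => (past δ 0 q.1, coupledPast δ m q))
      (fun q : Ω × Ω => (past δ 0 q.1, past δ 0 q.2)) (P.prod P) (P.prod P) where
  aemeasurable_fst := (((measurable_past h.measurable 0).comp measurable_fst).prodMk
    (measurable_coupledPast h.measurable m)).aemeasurable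
  aemeasurable_snd := (((measurable_past h.measurable 0).comp measurable_fst).prodMk
    ((measurable_past h.measurable 0).comp measurable_snd)).aemeasurable
  map_eq := by
    have h1 := map_reindex_eq (P := P.prod P) (D := twoCopies δ) (ν := P.map (δ 0))
      (φ := Sum.elim (fun j : ℕ => Sum.inl (0 - (j : ℤ)))
        (fun j : ℕ => if j < m then Sum.inl ((m : ℤ) - j) else Sum.inr ((m : ℤ) - j)))
      (ψ := Sum.elim (fun j : ℕ => Sum.inl (0 - (j : ℤ))) (fun j : ℕ => Sum.inr (0 - (j : ℤ))))
      (measurable_twoCopies h.measurable) h.iIndepFun_twoCopies h.map_twoCopies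
      (by
        rintro (a | a) (b | b) hab
        · simpa using hab
        · by_cases hb : b < m
          · simp [hb] at hab; omega
          · simp [hb] at hab
        · by_cases hb : a < m
          · simp [hb] at hab; omega
          · simp [hb] at hab
        · by_cases ha : a < m <;> by_cases hb : b < m <;> simp_all)
      (by rintro (a | a) (b | b) hab <;> simp_all)
    have hT : Measurable (fun s : ℕ ⊕ ℕ → S => (fun j => s (Sum.inl j), fun j => s (Sum.inr j))) := by
      fun_prop
    have h2 := congrArg (Measure.map
      (fun s : ℕ ⊕ ℕ → S => (fun j => s (Sum.inl j), fun j => s (Sum.inr j)))) h1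
    rw [Measure.map_map hT (measurable_pi_lambda _ fun i => measurable_twoCopies h.measurable _),
      Measure.map_map hT (measurable_pi_lambda _ fun i => measurable_twoCopies h.measurable _)] at h2
    convert h2 using 2
    · funext q
      refine Prod.ext rfl ?_
      funext j
      by_cases hj : j < m <;> simp [twoCopies, coupledPast, hj]
    · rfl

end IID

/-! ### Covariance bounds by coupling, and second moments of partial sums -/

section SecondMoments

variable {E : Type*} [NormedAddCommGroup E] [InnerProductSpace ℝ E]

section Inner

variable {α : Type*} [MeasurableSpace α] {μ : Measure α} {f g : α → E}

theorem integrable_inner_of_memLp (hf : MemLp f 2 μ) (hg : MemLp g 2 μ) :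
    Integrable (fun a => inner ℝ (f a) (g a)) μ :=
  (hf.norm.integrable_mul hg.norm).mono (hf.1.inner hg.1)
    (Eventually.of_forall fun a => by
      simpa using abs_real_inner_le_norm (f a) (g a))

theorem integral_norm_mul_norm_le {G : Type*} [NormedAddCommGroup G] {f g : α → G}
    (hf : MemLp f 2 μ) (hg : MemLp g 2 μ) :
    ∫ a, ‖f a‖ * ‖g a‖ ∂μ ≤ (eLpNorm f 2 μ).toReal * (eLpNorm g 2 μ).toReal := by
  have h := integral_mul_norm_le_Lp_mul_Lq (f := f) (g := g) (μ := μ) (p := 2) (q := 2)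
    ⟨by norm_num, by norm_num, by norm_num⟩ (by simpa using hf) (by simpa using hg)
  rw [hf.eLpNorm_eq_integral_rpow_norm (by simp) (by simp),
    hg.eLpNorm_eq_integral_rpow_norm (by simp) (by simp),
    ENNReal.toReal_ofReal (by positivity), ENNReal.toReal_ofReal (by positivity)]
  simpa using h

theorem abs_integral_inner_le (hf : MemLp f 2 μ) (hg : MemLp g 2 μ) :
    |∫ a, inner ℝ (f a) (g a) ∂μ| ≤ (eLpNorm f 2 μ).toReal * (eLpNorm g 2 μ).toReal := by
  refine le_trans (abs_integral_le_integral_abs) (le_trans ?_ (integral_norm_mul_norm_le hf hg))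
  exact integral_mono (integrable_inner_of_memLp hf hg).abs (hf.norm.integrable_mul hg.norm)
    fun a => abs_real_inner_le_norm _ _

end Inner

variable {Ω : Type*} {S : Type*} {δ : ℤ → Ω → S} {F : (ℕ → S) → E}

theorem past_eq_shift (δ : ℤ → Ω → S) (k : ℤ) (h : ℕ) (ω : Ω) :
    past δ k ω = fun j => past δ (k + h) ω (j + h) := by
  funext j
  simp [past]

variable [MeasurableSpace Ω] {P : Measure Ω}

theorem couplingError_eq {G : Type*} [NormedAddCommGroup G] (p : ENNReal) (δ : ℤ → Ω → S)
    (f : (ℕ → S) → G) (m : ℕ) :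
    couplingError P p δ f m = eLpNorm (fun q : Ω × Ω =>
      f (past δ m q.1) - f (coupledPast δ m q)) p (P.prod P) := rfl

variable [MeasurableSpace S]

section MemLp

variable {G : Type*} [NormedAddCommGroup G] {f : (ℕ → S) → G} {p : ENNReal}

theorem IsIID.memLp_past (h : IsIID P δ) (hf : StronglyMeasurable f) {l : ℤ}
    (hf2 : MemLp (fun ω => f (past δ l ω)) p P) (k : ℤ) :
    MemLp (fun ω => f (past δ k ω)) p P := by
  have h1 := (memLp_map_measure_iff hf.aestronglyMeasurable
    (measurable_past h.measurable l).aemeasurable).2 hf2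
  rw [← (h.identDistrib_past k l).map_eq] at h1
  exact (memLp_map_measure_iff hf.aestronglyMeasurable
    (measurable_past h.measurable k).aemeasurable).1 h1

theorem IsIID.eLpNorm_past (h : IsIID P δ) (hf : StronglyMeasurable f) (k l : ℤ) :
    eLpNorm (fun ω => f (past δ k ω)) p P = eLpNorm (fun ω => f (past δ l ω)) p P := by
  have h1 := eLpNorm_map_measure (p := p) (μ := P) hf.aestronglyMeasurable
    (measurable_past h.measurable k).aemeasurable
  have h2 := eLpNorm_map_measure (p := p) (μ := P) hf.aestronglyMeasurable
    (measurable_past h.measurable l).aemeasurable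
  rw [(h.identDistrib_past k l).map_eq, h2] at h1
  exact h1.symm

variable [IsProbabilityMeasure P]

theorem IsIID.memLp_coupledPast (h : IsIID P δ) (hf : StronglyMeasurable f)
    (hf2 : MemLp (fun ω => f (past δ 0 ω)) p P) (m : ℕ) :
    MemLp (fun q => f (coupledPast δ m q)) p (P.prod P) := by
  have h1 := (memLp_map_measure_iff hf.aestronglyMeasurable
    (measurable_past h.measurable 0).aemeasurable).2 hf2
  rw [← (h.identDistrib_coupledPast m).map_eq] at h1
  exact (memLp_map_measure_iff hf.aestronglyMeasurable
    (measurable_coupledPast h.measurable m).aemeasurable).1 h1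

theorem IsIID.eLpNorm_coupledPast (h : IsIID P δ) (hf : StronglyMeasurable f) (m : ℕ) :
    eLpNorm (fun q => f (coupledPast δ m q)) p (P.prod P)
      = eLpNorm (fun ω => f (past δ 0 ω)) p P := by
  have h1 := eLpNorm_map_measure (p := p) (μ := P.prod P) hf.aestronglyMeasurable
    (measurable_coupledPast h.measurable m).aemeasurable
  have h2 := eLpNorm_map_measure (p := p) (μ := P) hf.aestronglyMeasurable
    (measurable_past h.measurable 0).aemeasurable
  rw [(h.identDistrib_coupledPast m).map_eq, h2] at h1
  exact h1.symm

theorem IsIID.couplingError_ne_top (h : IsIID P δ) (hf : StronglyMeasurable f)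
    (hf2 : MemLp (fun ω => f (past δ 0 ω)) p P) (m : ℕ) : couplingError P p δ f m ≠ ⊤ := by
  rw [couplingError_eq]
  exact (((h.memLp_past hf hf2 m).comp_fst P).sub (h.memLp_coupledPast hf hf2 m)).eLpNorm_ne_top

end MemLp

/-- The earlier past is a tail of the later one, so the integrand is a single function of the later
past, whose law does not depend on time. -/
theorem IsIID.covariance_eq (h : IsIID P δ) (hF : StronglyMeasurable F) (k : ℤ) (m : ℕ) :
    ∫ ω, inner ℝ (F (past δ k ω)) (F (past δ (k + m) ω)) ∂P
      = ∫ ω, inner ℝ (F (past δ 0 ω)) (F (past δ m ω)) ∂P := by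
  have hG : Measurable fun s : ℕ → S => inner ℝ (F fun j => s (j + m)) (F s) :=
    ((hF.comp_measurable (by fun_prop)).inner hF).measurable
  have e0 : ∀ ω, past δ 0 ω = fun j => past δ m ω (j + m) := fun ω => by
    rw [past_eq_shift δ 0 m, zero_add]
  have := ((h.identDistrib_past (k + m) m).comp hG).integral_eq
  simp only [Function.comp_def] at this
  calc _ = ∫ ω, inner ℝ (F fun j => past δ (k + m) ω (j + m)) (F (past δ (k + m) ω)) ∂P :=
        integral_congr_ae (Eventually.of_forall fun ω => by
          simp only [past_eq_shift δ k m ω])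
    _ = _ := this
    _ = _ := integral_congr_ae (Eventually.of_forall fun ω => by simp only [e0])

/-- In law the pair is two independent copies, so Fubini applies. Centring is assumed weakly,
against every vector, so that `E` may be an incomplete space such as an algebraic tensor product. -/
theorem IsIID.integral_inner_coupledPast_eq_zero [IsProbabilityMeasure P] (h : IsIID P δ)
    (hF : StronglyMeasurable F) (hF2 : MemLp (fun ω => F (past δ 0 ω)) 2 P)
    (hF0 : ∀ e, ∫ ω, inner ℝ e (F (past δ 0 ω)) ∂P = 0) (m : ℕ) :
    ∫ q, inner ℝ (F (past δ 0 q.1)) (F (coupledPast δ m q)) ∂(P.prod P) = 0 := by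
  have hG : Measurable fun s : (ℕ → S) × (ℕ → S) => inner ℝ (F s.1) (F s.2) :=
    ((hF.comp_measurable measurable_fst).inner (hF.comp_measurable measurable_snd)).measurable
  have := ((h.identDistrib_past_coupledPast m).comp hG).integral_eq
  simp only [Function.comp_def] at this
  rw [this, integral_prod _ (integrable_inner_of_memLp (hF2.comp_fst P) (hF2.comp_snd P))]
  simp only [hF0, integral_zero]

/-- Subtracting the coupled copy from the later factor does not change the covariance;
Cauchy–Schwarz then yields the coupling error. -/
theorem IsIID.abs_covariance_le [IsProbabilityMeasure P] (h : IsIID P δ)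
    (hF : StronglyMeasurable F) (hF2 : MemLp (fun ω => F (past δ 0 ω)) 2 P)
    (hF0 : ∀ e, ∫ ω, inner ℝ e (F (past δ 0 ω)) ∂P = 0) (k : ℤ) (m : ℕ) :
    |∫ ω, inner ℝ (F (past δ k ω)) (F (past δ (k + m) ω)) ∂P|
      ≤ (eLpNorm (fun ω => F (past δ 0 ω)) 2 P).toReal * (couplingError P 2 δ F m).toReal := by
  have hfst : MemLp (fun q : Ω × Ω => F (past δ 0 q.1)) 2 (P.prod P) := hF2.comp_fst P
  have hfstm : MemLp (fun q : Ω × Ω => F (past δ m q.1)) 2 (P.prod P) :=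
    (h.memLp_past hF hF2 m).comp_fst P
  have hcp := h.memLp_coupledPast hF hF2 m
  have hsplit : ∫ ω, inner ℝ (F (past δ 0 ω)) (F (past δ m ω)) ∂P
      = ∫ q, inner ℝ (F (past δ 0 q.1)) (F (past δ m q.1) - F (coupledPast δ m q))
        ∂(P.prod P) := by
    simp_rw [inner_sub_right]
    rw [integral_sub (integrable_inner_of_memLp hfst hfstm) (integrable_inner_of_memLp hfst hcp),
      h.integral_inner_coupledPast_eq_zero hF hF2 hF0, sub_zero,
      integral_fun_fst (fun ω => inner ℝ (F (past δ 0 ω)) (F (past δ m ω)))]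
    simp
  have hnorm : eLpNorm (fun q : Ω × Ω => F (past δ 0 q.1)) 2 (P.prod P)
      = eLpNorm (fun ω => F (past δ 0 ω)) 2 P :=
    eLpNorm_comp_measurePreserving (g := fun ω => F (past δ 0 ω)) (f := Prod.fst) hF2.1
      measurePreserving_fst
  rw [h.covariance_eq hF, hsplit, couplingError_eq, ← hnorm]
  exact abs_integral_inner_le hfst (hfstm.sub hcp)

/-- The partial sums of a centred, weakly dependent stationary sequence have second moments of
linear order. -/
theorem IsIID.exists_integral_norm_sq_sum_le [IsProbabilityMeasure P] (h : IsIID P δ)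
    (hF : StronglyMeasurable F)
    (hF2 : MemLp (fun ω => F (past δ 0 ω)) 2 P)
    (hF0 : ∀ e, ∫ ω, inner ℝ e (F (past δ 0 ω)) ∂P = 0)
    (hsum : ∑' m : ℕ, couplingError P 2 δ F (m + 1) ≠ ⊤) (a : ℤ) :
    ∃ c : ℝ, 0 ≤ c ∧ ∀ n : ℕ,
      ∫ ω, ‖∑ k ∈ Finset.range n, F (past δ (k + a) ω)‖ ^ 2 ∂P ≤ c * n := by
  set M := (eLpNorm (fun ω => F (past δ 0 ω)) 2 P).toReal with hM
  have hM0 : 0 ≤ M := ENNReal.toReal_nonneg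
  set e : ℕ → ℝ := fun m => (couplingError P 2 δ F m).toReal with he
  have he0 : ∀ m, 0 ≤ e m := fun m => ENNReal.toReal_nonneg
  have hes : Summable fun m => e (m + 1) := ENNReal.summable_toReal hsum
  have hmem := h.memLp_past hF hF2
  set B := ∑' m, e (m + 1) with hB
  have hB0 : 0 ≤ B := tsum_nonneg fun m => he0 _
  have hT : ∀ n : ℕ, MemLp (fun ω => ∑ k ∈ Finset.range n, F (past δ (k + a) ω)) 2 P :=
    fun n => memLp_finsetSum _ fun k _ => hmem _
  -- Each new summand contributes its own second moment, at most `M * M`, and twice its covariance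
  -- with the previous sum, at most `M * B`.
  refine ⟨2 * (M * B) + M * M, by positivity, fun n => ?_⟩
  induction n with
  | zero => simp
  | succ n ih =>
    simp_rw [Finset.sum_range_succ, norm_add_sq_real]
    have i1 : Integrable (fun ω => ‖∑ k ∈ Finset.range n, F (past δ (k + a) ω)‖ ^ 2) P :=
      (hT n).integrable_norm_pow (by norm_num)
    have i2 := integrable_inner_of_memLp (hT n) (hmem (n + a))
    have i3 : Integrable (fun ω => ‖F (past δ (n + a) ω)‖ ^ 2) P :=
      (hmem (n + a)).integrable_norm_pow (by norm_num)
    rw [integral_add (by exact i1.add (i2.const_mul 2)) i3, integral_add i1 (i2.const_mul 2),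
      integral_const_mul]
    have h3 : ∫ ω, ‖F (past δ (n + a) ω)‖ ^ 2 ∂P ≤ M * M := by
      have := integral_norm_mul_norm_le (hmem (n + a)) (hmem (n + a))
      rw [h.eLpNorm_past hF _ 0] at this
      simpa [sq] using this
    have h2 : ∫ ω, inner ℝ (∑ k ∈ Finset.range n, F (past δ (k + a) ω)) (F (past δ (n + a) ω)) ∂P
        ≤ M * B := by
      simp_rw [sum_inner]
      rw [integral_finsetSum _ fun k _ => integrable_inner_of_memLp (hmem _) (hmem _)]
      calc ∑ k ∈ Finset.range n, ∫ ω, inner ℝ (F (past δ (k + a) ω)) (F (past δ (n + a) ω)) ∂P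
          -- The lag `n - k` is positive; written this way, reflecting the sum turns it into a
          -- partial sum of `B`.
          ≤ ∑ k ∈ Finset.range n, M * e (n - 1 - k + 1) := by
            refine Finset.sum_le_sum fun k hk => ?_
            have hk := Finset.mem_range.1 hk
            have := h.abs_covariance_le hF hF2 hF0 (k + a) (n - 1 - k + 1)
            have hidx : ((k : ℤ) + a + ((n - 1 - k + 1 : ℕ) : ℤ)) = n + a := by omega
            rw [hidx] at this
            exact (le_abs_self _).trans this
        _ = M * ∑ k ∈ Finset.range n, e (k + 1) := by
            rw [← Finset.mul_sum, Finset.sum_range_reflect (fun k => e (k + 1)) n]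
        _ ≤ M * B := by
            gcongr
            exact hes.sum_le_tsum _ fun m _ => he0 _
    push_cast
    linarith

end SecondMoments

/-! ### Deterministic spectral estimates for the principal component estimator -/

section Spectral

variable {H : Type*} [NormedAddCommGroup H] [InnerProductSpace ℝ H]

section OrthonormalSums

variable {ι : Type*} {s : Finset ι} {v : ι → H}

theorem norm_sq_orthonormal_sum (hv : Orthonormal ℝ (fun j : s => v j)) (a : ι → ℝ) :
    ‖∑ j ∈ s, a j • v j‖ ^ 2 = ∑ j ∈ s, a j ^ 2 := by
  have := hv.inner_sum (fun j => a j) (fun j => a j) Finset.univ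
  rw [← real_inner_self_eq_norm_sq, ← Finset.sum_coe_sort s (fun j => a j • v j), this,
    ← Finset.sum_coe_sort s (fun j => a j ^ 2)]
  exact Finset.sum_congr rfl fun j _ => by simp [sq]

theorem inner_orthonormal_sum (hv : Orthonormal ℝ (fun j : s => v j)) (a : ι → ℝ) {i : ι}
    (hi : i ∈ s) : inner ℝ (v i) (∑ j ∈ s, a j • v j) = a i := by
  rw [← Finset.sum_coe_sort s (fun j => a j • v j)]
  exact hv.inner_right_fintype (fun j : s => a j) ⟨i, hi⟩

theorem sum_inner_sq_le (hv : Orthonormal ℝ (fun j : s => v j)) (x : H) :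
    ∑ j ∈ s, inner ℝ (v j) x ^ 2 ≤ ‖x‖ ^ 2 := by
  have := hv.sum_inner_products_le x (s := Finset.univ)
  rw [← Finset.sum_coe_sort s (fun j => inner ℝ (v j) x ^ 2)]
  simpa using this

theorem norm_orthonormal_sum_le (hv : Orthonormal ℝ (fun j : s => v j)) {a : ι → ℝ} {x : H}
    {τ : ℝ} (hτ : 0 ≤ τ) (ha : ∀ j ∈ s, |a j| ≤ τ * |inner ℝ (v j) x|) :
    ‖∑ j ∈ s, a j • v j‖ ≤ τ * ‖x‖ := by
  refine abs_le_of_sq_le_sq' ?_ (by positivity) |>.2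
  rw [norm_sq_orthonormal_sum hv, mul_pow]
  calc ∑ j ∈ s, a j ^ 2 ≤ ∑ j ∈ s, τ ^ 2 * inner ℝ (v j) x ^ 2 :=
        Finset.sum_le_sum fun j hj => by
          rw [← mul_pow]
          exact sq_le_sq.2 (by simpa [abs_mul, abs_of_nonneg hτ] using ha j hj)
    _ ≤ τ ^ 2 * ‖x‖ ^ 2 := by
        rw [← Finset.mul_sum]
        gcongr
        exact sum_inner_sq_le hv x

theorem norm_sub_orthonormal_proj_le (hv : Orthonormal ℝ (fun j : s => v j)) (x : H) :
    ‖x - ∑ j ∈ s, inner ℝ (v j) x • v j‖ ≤ ‖x‖ := by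
  refine abs_le_of_sq_le_sq' ?_ (by positivity) |>.2
  have h1 : inner ℝ x (∑ j ∈ s, inner ℝ (v j) x • v j) = ∑ j ∈ s, inner ℝ (v j) x ^ 2 := by
    rw [inner_sum]
    exact Finset.sum_congr rfl fun j _ => by
      rw [inner_smul_right, real_inner_comm, sq]
  rw [norm_sub_sq_real, h1, norm_sq_orthonormal_sum hv]
  have : 0 ≤ ∑ j ∈ s, inner ℝ (v j) x ^ 2 := Finset.sum_nonneg fun j _ => sq_nonneg _
  linarith

end OrthonormalSums

namespace IsEigensystem

variable {T : H →L[ℝ] H} {lam : ℕ → ℝ} {v : ℕ → H}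

theorem orthonormal_finset (h : IsEigensystem T lam v) {s : Finset ℕ}
    (hs : ∀ j ∈ s, 1 ≤ j ∧ lam j ≠ 0) : Orthonormal ℝ (fun j : s => v j) :=
  h.orthonormal.comp (fun j : s => (⟨j, hs j j.2⟩ : {j : ℕ // 1 ≤ j ∧ lam j ≠ 0}))
    fun a b hab => Subtype.ext (by simpa using hab)

theorem apply_eigenvector (h : IsEigensystem T lam v) {j : ℕ} (hj : 1 ≤ j) (hl : lam j ≠ 0) :
    T (v j) = lam j • v j := by
  have h1 := h.hasSum (v j)
  have hon := orthonormal_iff_ite.1 h.orthonormal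
  have h2 := hasSum_single (f := fun i : ℕ => lam (i + 1) • tensor (v (i + 1)) (v (i + 1)) (v j))
    (j - 1) (fun i hi => by
      by_cases hz : lam (i + 1) = 0
      · simp [hz]
      · have := hon ⟨i + 1, by omega, hz⟩ ⟨j, hj, hl⟩
        rw [if_neg (by simp; omega)] at this
        simp only at this
        simp [tensor_apply, this])
  have h3 := h1.unique h2
  have h4 := hon ⟨j, hj, hl⟩ ⟨j, hj, hl⟩
  simp only [if_true] at h4
  rw [h3]
  simp only [Nat.sub_add_cancel hj, tensor_apply, h4, one_smul]

/-- Bessel's inequality applied to the eigenexpansion of the quadratic form. -/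
theorem inner_apply_le (h : IsEigensystem T lam v) (x : H) :
    inner ℝ (T x) x ≤ lam 1 * ‖x‖ ^ 2 := by
  have hs : HasSum (fun j : ℕ => lam (j + 1) * inner ℝ (v (j + 1)) x ^ 2) (inner ℝ (T x) x) := by
    have := (h.hasSum x).mapL (innerSL ℝ x)
    simp only [innerSL_apply_apply, tensor_apply, inner_smul_right] at this
    rw [real_inner_comm]
    refine this.congr_fun fun j => ?_
    rw [real_inner_comm x, sq]
  refine hasSum_le_of_sum_le hs fun s => ?_
  have hinj : Function.Injective fun j : ℕ => j + 1 := add_left_injective 1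
  -- Vectors with eigenvalue zero are arbitrary, so Bessel's inequality is available only after
  -- discarding them.
  set t := (s.map ⟨_, hinj⟩).filter (fun j => lam j ≠ 0) with ht
  have hst : ∑ j ∈ s, lam (j + 1) * inner ℝ (v (j + 1)) x ^ 2
      = ∑ j ∈ t, lam j * inner ℝ (v j) x ^ 2 := by
    rw [ht, Finset.sum_filter_of_ne (p := fun j => lam j ≠ 0)
      (fun j _ hj hz => hj (by rw [hz, zero_mul])), Finset.sum_map]
    rfl
  have ht1 : ∀ j ∈ t, 1 ≤ j ∧ lam j ≠ 0 := by
    intro j hj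
    simp only [ht, Finset.mem_filter, Finset.mem_map, Function.Embedding.coeFn_mk] at hj
    obtain ⟨⟨i, _, rfl⟩, hz⟩ := hj
    exact ⟨by omega, hz⟩
  rw [hst]
  calc ∑ j ∈ t, lam j * inner ℝ (v j) x ^ 2 ≤ ∑ j ∈ t, lam 1 * inner ℝ (v j) x ^ 2 :=
        Finset.sum_le_sum fun j hj => by
          have := h.antitone 1 j le_rfl (ht1 j hj).1
          gcongr
    _ ≤ lam 1 * ‖x‖ ^ 2 := by
        rw [← Finset.mul_sum]
        exact mul_le_mul_of_nonneg_left (sum_inner_sq_le (h.orthonormal_finset ht1) x)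
          (h.nonneg 1 le_rfl)

end IsEigensystem

section Truncation

variable {n : ℕ} {m : ℝ} {lam : ℕ → ℝ}

theorem truncationLevel_bddAbove (n : ℕ) (m : ℝ) (lam : ℕ → ℝ) :
    BddAbove {j : ℕ | 1 ≤ j ∧ j ≤ n ∧ 0 < lam j ∧ lam 1 / lam j ≤ m} :=
  ⟨n, fun _ hj => hj.2.1⟩

theorem truncationLevel_le (n : ℕ) (m : ℝ) (lam : ℕ → ℝ) : truncationLevel n m lam ≤ n :=
  csSup_le' fun _ hj => hj.2.1

/-- The defining condition holds at the maximum and is inherited by smaller indices because the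
eigenvalues decrease. The set is nonempty since `sSup ∅ = 0 < j`. -/
theorem le_of_le_truncationLevel (hanti : ∀ i j, 1 ≤ i → i ≤ j → lam j ≤ lam i)
    (h1 : 0 ≤ lam 1) {j : ℕ} (hj : 1 ≤ j) (hjK : j ≤ truncationLevel n m lam) :
    0 < lam j ∧ lam 1 / lam j ≤ m := by
  have hne : {j : ℕ | 1 ≤ j ∧ j ≤ n ∧ 0 < lam j ∧ lam 1 / lam j ≤ m}.Nonempty := by
    by_contra hemp
    rw [Set.not_nonempty_iff_eq_empty] at hemp
    have : truncationLevel n m lam = 0 := by rw [truncationLevel, hemp]; simp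
    omega
  obtain ⟨_, _, hpos, hle⟩ := Nat.sSup_mem hne (truncationLevel_bddAbove n m lam)
  have hmono := hanti j _ hj hjK
  refine ⟨hpos.trans_le hmono, le_trans ?_ hle⟩
  exact div_le_div_of_nonneg_left h1 hpos hmono

theorem lt_div_of_truncationLevel_lt {j : ℕ} (hj : 1 ≤ j) (hjn : j ≤ n) (hpos : 0 < lam j)
    (hK : truncationLevel n m lam < j) : m < lam 1 / lam j := by
  by_contra hle
  exact absurd (le_csSup (truncationLevel_bddAbove n m lam) ⟨hj, hjn, hpos, not_lt.1 hle⟩)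
    (not_le.2 hK)

end Truncation

section Empirical

variable {n : ℕ} {x : ℕ → H} {lam : ℕ → ℝ} {v : ℕ → H}

theorem empiricalOperator_apply {H₂ : Type*} [NormedAddCommGroup H₂] [InnerProductSpace ℝ H₂]
    (n : ℕ) (x : ℕ → H) (y : ℕ → H₂) (z : H) :
    empiricalOperator n x y z = (n : ℝ)⁻¹ • ∑ k ∈ Finset.Icc 1 n, inner ℝ (x k) z • y k := by
  simp [empiricalOperator, tensor_apply]

/-- The norm on the right is the Hilbert–Schmidt norm, which comes from an inner product and so
admits the second moment bound. The proof pairs the tensor with `z ⊗ w`, where `w` is the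
unnormalized image of `z`. -/
theorem norm_empiricalOperator_le {H₂ : Type*} [NormedAddCommGroup H₂] [InnerProductSpace ℝ H₂]
    (n : ℕ) (x : ℕ → H) (y : ℕ → H₂) :
    ‖empiricalOperator n x y‖
      ≤ (n : ℝ)⁻¹ * ‖∑ k ∈ Finset.Icc 1 n, x k ⊗ₜ[ℝ] y k‖ := by
  refine ContinuousLinearMap.opNorm_le_bound _ (by positivity) fun z => ?_
  rw [empiricalOperator_apply, norm_smul, norm_inv, Real.norm_natCast, mul_assoc]
  gcongr
  set w := ∑ k ∈ Finset.Icc 1 n, inner ℝ (x k) z • y k with hw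
  have h1 : inner ℝ (∑ k ∈ Finset.Icc 1 n, x k ⊗ₜ[ℝ] y k) (z ⊗ₜ[ℝ] w) = ‖w‖ ^ 2 := by
    rw [← real_inner_self_eq_norm_sq]
    nth_rw 2 [hw]
    simp [sum_inner, inner_smul_left]
  have h2 := real_inner_le_norm (∑ k ∈ Finset.Icc 1 n, x k ⊗ₜ[ℝ] y k) (z ⊗ₜ[ℝ] w)
  rw [h1, TensorProduct.norm_tmul] at h2
  rcases (norm_nonneg w).eq_or_lt with h0 | h0
  · rw [← h0]; positivity
  · nlinarith

/-- Otherwise `j > n` orthonormal eigenvectors would lie in the span of `n` observations. Hence the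
bound `j ≤ n` in `truncationLevel` excludes no positive eigenvalue. -/
theorem IsEigensystem.eq_zero_of_lt (h : IsEigensystem (empiricalOperator n x x) lam v) {j : ℕ}
    (hj : n < j) : lam j = 0 := by
  by_contra hne
  have hpos : ∀ i, 1 ≤ i → i ≤ j → lam i ≠ 0 := fun i hi hij =>
    ((lt_of_le_of_ne (h.nonneg j (by omega)) (Ne.symm hne)).trans_le (h.antitone i j hi hij)).ne'
  have hs : ∀ i ∈ Finset.Icc 1 j, 1 ≤ i ∧ lam i ≠ 0 := fun i hi => by
    rw [Finset.mem_Icc] at hi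
    exact ⟨hi.1, hpos i hi.1 hi.2⟩
  have hli := (h.orthonormal_finset hs).linearIndependent
  set W := Submodule.span ℝ (Set.range fun k : Finset.Icc 1 n => x k) with hW
  have hmem : ∀ i : Finset.Icc 1 j, v i ∈ W := fun i => by
    obtain ⟨h1, h2⟩ := hs i i.2
    have h3 : v i = (lam i)⁻¹ • empiricalOperator n x x (v i) := by
      rw [h.apply_eigenvector h1 h2, smul_smul, inv_mul_cancel₀ h2, one_smul]
    rw [h3, empiricalOperator_apply]
    exact W.smul_mem _ (W.smul_mem _ (W.sum_mem fun k hk =>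
      W.smul_mem _ (Submodule.subset_span ⟨⟨k, hk⟩, rfl⟩)))
  have hfin : Module.finrank ℝ W ≤ n := by
    have := finrank_range_le_card (R := ℝ) (fun k : Finset.Icc 1 n => x k)
    rwa [Fintype.card_coe, Nat.card_Icc, Nat.add_sub_cancel] at this
  have hli' : LinearIndependent ℝ (fun i : Finset.Icc 1 j => (⟨v i, hmem i⟩ : W)) :=
    LinearIndependent.of_comp W.subtype hli
  have : FiniteDimensional ℝ W := FiniteDimensional.span_of_finite ℝ (Set.finite_range _)
  have := hli'.fintype_card_le_finrank
  simp at this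
  omega

theorem IsEigensystem.apply_eq_sum (h : IsEigensystem (empiricalOperator n x x) lam v) (z : H) :
    empiricalOperator n x x z
      = ∑ j ∈ (Finset.Icc 1 n).filter (fun j => lam j ≠ 0), (lam j * inner ℝ (v j) z) • v j := by
  have h1 : HasSum (fun j : ℕ => lam (j + 1) • tensor (v (j + 1)) (v (j + 1)) z)
      (∑ j ∈ Finset.range n, lam (j + 1) • tensor (v (j + 1)) (v (j + 1)) z) :=
    hasSum_sum_of_ne_finset_zero fun j hj => by
      rw [h.eq_zero_of_lt (by simpa [Nat.lt_succ_iff] using hj), zero_smul]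
  rw [(h.hasSum z).unique h1,
    Finset.sum_filter_of_ne (p := fun j => lam j ≠ 0)
      (fun j _ hj hz => hj (by rw [hz, zero_mul, zero_smul])), Finset.range_eq_Ico,
    Finset.sum_Ico_add' (fun j => lam j • tensor (v j) (v j) z)]
  simp only [tensor_apply, smul_smul, zero_add]
  rfl

/-- The right side is the trace of the empirical covariance operator; its expectation is bounded in
`n`. -/
theorem IsEigensystem.le_mean_norm_sq (h : IsEigensystem (empiricalOperator n x x) lam v) :
    lam 1 ≤ (n : ℝ)⁻¹ * ∑ k ∈ Finset.Icc 1 n, ‖x k‖ ^ 2 := by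
  rcases eq_or_ne (lam 1) 0 with h0 | h0
  · rw [h0]; positivity
  have hv : ‖v 1‖ = 1 := h.orthonormal.1 ⟨1, le_rfl, h0⟩
  have h1 : lam 1 = inner ℝ (v 1) (empiricalOperator n x x (v 1)) := by
    rw [h.apply_eigenvector le_rfl h0, inner_smul_right, real_inner_self_eq_norm_sq, hv]; simp
  rw [h1, empiricalOperator_apply, inner_smul_right, inner_sum]
  gcongr with k hk
  rw [inner_smul_right, real_inner_comm]
  have := abs_real_inner_le_norm (v 1) (x k)
  rw [hv, one_mul] at this
  nlinarith [abs_nonneg (inner ℝ (v 1) (x k)), abs_mul_abs_self (inner ℝ (v 1) (x k))]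

/-- The deterministic error bound behind the consistency of the principal component estimator. -/
theorem IsEigensystem.norm_sub_pcEstimator_le
    (h : IsEigensystem (empiricalOperator n x x) lam v) {Ψ : H →L[ℝ] H} (hΨ : ‖Ψ‖ ≤ 1)
    {y e : ℕ → H} (hy : ∀ k, 1 ≤ k → y k = Ψ (x k) + e k) {m : ℝ} (hm : 0 < m) (z c d : H) :
    ‖Ψ z - pcEstimator n (truncationLevel n m lam) x y lam v z‖
      ≤ ‖z - c‖ + ‖empiricalOperator n x x d - c‖ + lam 1 / m * ‖d‖
        + ‖empiricalOperator n x e‖ * (m / lam 1 * ‖z‖) := by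
  set K := truncationLevel n m lam with hK
  set T := empiricalOperator n x x with hT
  have hl1 := h.nonneg 1 le_rfl
  have hlow : ∀ j ∈ Finset.Icc 1 K, 0 < lam j ∧ lam 1 / lam j ≤ m := fun j hj =>
    le_of_le_truncationLevel h.antitone hl1 (Finset.mem_Icc.1 hj).1 (Finset.mem_Icc.1 hj).2
  have hon : Orthonormal ℝ (fun j : Finset.Icc 1 K => v j) := h.orthonormal_finset fun j hj =>
    ⟨(Finset.mem_Icc.1 hj).1, (hlow j hj).1.ne'⟩
  set proj : H → H := fun w => ∑ j ∈ Finset.Icc 1 K, inner ℝ (v j) w • v j with hproj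
  have hproj_add : ∀ a b, proj (a + b) = proj a + proj b := fun a b => by
    simp [hproj, inner_add_right, add_smul, Finset.sum_add_distrib]
  -- The estimator at `z` is the empirical cross operator at `g`, and `g` is a preimage under `T` of
  -- the projection of `z`.
  set g := ∑ j ∈ Finset.Icc 1 K, (inner ℝ (v j) z / lam j) • v j with hg
  have hTg : T g = proj z := by
    simp only [hg, hproj, map_sum, map_smul]
    refine Finset.sum_congr rfl fun j hj => ?_
    rw [h.apply_eigenvector (Finset.mem_Icc.1 hj).1 (hlow j hj).1.ne', smul_smul,
      div_mul_cancel₀ _ (hlow j hj).1.ne']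
  have hpc : pcEstimator n K x y lam v z = Ψ (proj z) + empiricalOperator n x e g := by
    have h1 : pcEstimator n K x y lam v z = empiricalOperator n x y g := by
      simp [pcEstimator, hg]
    have h2 : ∀ w, empiricalOperator n x y w = Ψ (T w) + empiricalOperator n x e w := fun w => by
      simp only [hT, empiricalOperator_apply, map_smul, map_sum, ← smul_add,
        ← Finset.sum_add_distrib]
      congr 1
      exact Finset.sum_congr rfl fun k hk => by rw [hy k (Finset.mem_Icc.1 hk).1]
    rw [h1, h2, hTg]
  -- For `j ≤ K`, `1 / λ_j ≤ m / λ_1`. If `lam 1 = 0`, the sum is empty and both sides are zero.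
  have hgn : ‖g‖ ≤ m / lam 1 * ‖z‖ := by
    refine norm_orthonormal_sum_le hon (by positivity) fun j hj => ?_
    obtain ⟨hp, hle⟩ := hlow j hj
    have hp1 : 0 < lam 1 := hp.trans_le (h.antitone 1 j le_rfl (Finset.mem_Icc.1 hj).1)
    rw [abs_div, abs_of_pos hp, div_le_iff₀ hp, mul_right_comm]
    refine le_mul_of_one_le_left (abs_nonneg _) ?_
    rw [div_le_iff₀ hp] at hle
    rw [div_mul_eq_mul_div, le_div_iff₀ hp1]
    linarith
  -- The remaining coefficients `λ_j ⟨v_j, d⟩` have `j > K`, hence `λ_j < λ_1 / m` by maximality of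
  -- `K`.
  have htail : ‖T d - proj (T d)‖ ≤ lam 1 / m * ‖d‖ := by
    set s := (Finset.Icc 1 n).filter (fun j => lam j ≠ 0) with hs
    have hs1 : ∀ j ∈ s, 1 ≤ j ∧ lam j ≠ 0 := fun j hj => by
      rw [hs, Finset.mem_filter, Finset.mem_Icc] at hj
      exact ⟨hj.1.1, hj.2⟩
    have hTd : T d = ∑ j ∈ s, (lam j * inner ℝ (v j) d) • v j := h.apply_eq_sum d
    have hsub : Finset.Icc 1 K ⊆ s := fun j hj => by
      have := (hlow j hj).1.ne'
      rw [Finset.mem_Icc] at hj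
      rw [hs, Finset.mem_filter, Finset.mem_Icc]
      exact ⟨⟨hj.1, hj.2.trans (truncationLevel_le _ _ _)⟩, this⟩
    have hpTd : proj (T d) = ∑ j ∈ Finset.Icc 1 K, (lam j * inner ℝ (v j) d) • v j :=
      Finset.sum_congr rfl fun j hj => by
        rw [hTd, inner_orthonormal_sum (h.orthonormal_finset hs1) _ (hsub hj)]
    rw [hpTd, hTd, ← Finset.sum_sdiff hsub, add_sub_cancel_right]
    refine norm_orthonormal_sum_le (h.orthonormal_finset fun j hj =>
      hs1 j (Finset.mem_sdiff.1 hj).1) (by positivity) fun j hj => ?_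
    rw [Finset.mem_sdiff] at hj
    have hj1 := hs1 j hj.1
    have hp : 0 < lam j := lt_of_le_of_ne (h.nonneg j hj1.1) (Ne.symm hj1.2)
    have hjn : j ≤ n := (Finset.mem_Icc.1 (Finset.mem_filter.1 hj.1).1).2
    have hKj : K < j := by
      by_contra hle
      exact hj.2 (Finset.mem_Icc.2 ⟨hj1.1, not_lt.1 hle⟩)
    have := lt_div_of_truncationLevel_lt hj1.1 hjn hp hKj
    rw [abs_mul, abs_of_pos hp]
    gcongr
    rw [lt_div_iff₀ hp] at this
    rw [le_div_iff₀ hm]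
    linarith
  have hz : ‖z - proj z‖ ≤ ‖z - c‖ + ‖T d - c‖ + lam 1 / m * ‖d‖ := by
    have hdec : z - proj z = ((z - c) - proj (z - c)) + ((c - T d) - proj (c - T d))
        + (T d - proj (T d)) := by
      have h1 : proj z = proj (z - c) + proj (c - T d) + proj (T d) := by
        rw [← hproj_add, ← hproj_add]; congr 1; abel
      rw [h1]; abel
    rw [hdec]
    refine (norm_add_le _ _).trans (add_le_add ((norm_add_le _ _).trans (add_le_add
      (norm_sub_orthonormal_proj_le hon _) ?_)) htail)
    rw [norm_sub_rev (T d) c]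
    exact norm_sub_orthonormal_proj_le hon _
  rw [hpc, ← sub_sub, ← map_sub]
  refine (norm_sub_le _ _).trans (add_le_add ?_ ?_)
  · exact ((Ψ.le_opNorm _).trans (mul_le_of_le_one_left (norm_nonneg _) hΨ)).trans hz
  · exact (ContinuousLinearMap.le_opNorm _ _).trans (by gcongr)

theorem pcEstimator_zero {H₂ : Type*} [NormedAddCommGroup H₂] [InnerProductSpace ℝ H₂]
    (n K : ℕ) (x : ℕ → H) (y : ℕ → H₂) (lam : ℕ → ℝ) (v : ℕ → H) :
    pcEstimator n K x y lam v 0 = 0 := by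
  simp [pcEstimator]

end Empirical

end Spectral

/-! ### Coupling errors of shifts, linear images and bilinear products -/

section Coupling

variable {Ω : Type*} {S : Type*} {δ : ℤ → Ω → S}

theorem past_tail (δ : ℤ → Ω → S) (k : ℤ) (ω : Ω) :
    (fun j => past δ (k + 1) ω (j + 1)) = past δ k ω := by
  funext j
  simp [past]

theorem coupledPast_tail (δ : ℤ → Ω → S) (m : ℕ) (q : Ω × Ω) :
    (fun j => coupledPast δ (m + 1) q (j + 1)) = coupledPast δ m q := by
  funext j
  simp [coupledPast]

variable [MeasurableSpace Ω] {P : Measure Ω}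

/-- Ignoring the newest innovation delays the process by one step, which lets `X_k` be read as a
function of the past at time `k + 1`. -/
theorem couplingError_tail {G : Type*} [NormedAddCommGroup G] (p : ENNReal) (δ : ℤ → Ω → S)
    (f : (ℕ → S) → G) (m : ℕ) :
    couplingError P p δ (fun s => f fun j => s (j + 1)) (m + 1) = couplingError P p δ f m := by
  simp only [couplingError_eq, coupledPast_tail, Nat.cast_add, Nat.cast_one, past_tail]

variable {E₁ E₂ E : Type*} [NormedAddCommGroup E₁] [NormedSpace ℝ E₁] [NormedAddCommGroup E₂]
  [NormedSpace ℝ E₂] [NormedAddCommGroup E] [NormedSpace ℝ E]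

theorem memLp_bilin_past [IsFiniteMeasure P] {u : (ℕ → S) → E₁} {w : (ℕ → S) → E₂}
    (B : E₁ →L[ℝ] E₂ →L[ℝ] E) (e : E)
    (hu4 : MemLp (fun ω => u (past δ 0 ω)) 4 P) (hw4 : MemLp (fun ω => w (past δ 0 ω)) 4 P) :
    MemLp (fun ω => B (u (past δ 0 ω)) (w (past δ 0 ω)) - e) 2 P := by
  have : ENNReal.HolderTriple 4 4 2 := ⟨by
    rw [← two_mul, show (4 : ENNReal) = 2 * 2 by norm_num,
      ENNReal.mul_inv (by simp) (by simp), ← mul_assoc, ENNReal.mul_inv_cancel (by simp) (by simp),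
      one_mul]⟩
  exact (B.memLp_of_bilin 2 hu4 hw4).sub (memLp_const e)

variable [MeasurableSpace S]

theorem IsIID.couplingError_sub_clm_le (h : IsIID P δ) {p : ENNReal} (hp : 1 ≤ p)
    {f : (ℕ → S) → E} {g : (ℕ → S) → E₁} (hf : StronglyMeasurable f) (hg : StronglyMeasurable g)
    (Ψ : E₁ →L[ℝ] E) (m : ℕ) :
    couplingError P p δ (fun s => f s - Ψ (g s)) m
      ≤ couplingError P p δ f m + ‖Ψ‖ₑ * couplingError P p δ g m := by
  have hs : Measurable fun q : Ω × Ω => past δ m q.1 :=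
    (measurable_past h.measurable m).comp measurable_fst
  have hc := measurable_coupledPast h.measurable m
  have h1 := (hf.comp_measurable hs).sub (hf.comp_measurable hc)
  have h2 := (hg.comp_measurable hs).sub (hg.comp_measurable hc)
  simp only [couplingError_eq]
  calc eLpNorm (fun q : Ω × Ω => f (past δ m q.1) - Ψ (g (past δ m q.1))
        - (f (coupledPast δ m q) - Ψ (g (coupledPast δ m q)))) p (P.prod P)
      = eLpNorm ((fun q : Ω × Ω => f (past δ m q.1) - f (coupledPast δ m q))
        - fun q => Ψ (g (past δ m q.1) - g (coupledPast δ m q))) p (P.prod P) := by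
        congr 1
        funext q
        simp only [Pi.sub_apply, map_sub]
        abel
    _ ≤ _ := eLpNorm_sub_le h1.aestronglyMeasurable
        (Ψ.continuous.comp_aestronglyMeasurable h2.aestronglyMeasurable) hp
    _ ≤ _ := by
        gcongr
        refine eLpNorm_le_nnreal_smul_eLpNorm_of_ae_le_mul (c := ‖Ψ‖₊)
          (Eventually.of_forall fun q => ?_) p
        exact Ψ.le_opNNNorm _

variable [IsProbabilityMeasure P] {u : (ℕ → S) → E₁} {w : (ℕ → S) → E₂}

/-- Write `B(u, w) - B(u', w') = B(u - u', w) + B(u', w - w')` and use Hölder with `1/4 + 1/4 =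
1/2`: second moments of products cost fourth moments of factors. -/
theorem IsIID.couplingError_bilin_le (h : IsIID P δ) (B : E₁ →L[ℝ] E₂ →L[ℝ] E) (e : E)
    (hu : StronglyMeasurable u) (hw : StronglyMeasurable w) (m : ℕ) :
    couplingError P 2 δ (fun s => B (u s) (w s) - e) m
      ≤ ‖B‖ₑ * (couplingError P 4 δ u m * eLpNorm (fun ω => w (past δ 0 ω)) 4 P)
        + ‖B‖ₑ * (eLpNorm (fun ω => u (past δ 0 ω)) 4 P * couplingError P 4 δ w m) := by
  have : ENNReal.HolderTriple 4 4 2 := ⟨by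
    rw [← two_mul, show (4 : ENNReal) = 2 * 2 by norm_num,
      ENNReal.mul_inv (by simp) (by simp), ← mul_assoc, ENNReal.mul_inv_cancel (by simp) (by simp),
      one_mul]⟩
  have hs : Measurable fun q : Ω × Ω => past δ m q.1 :=
    (measurable_past h.measurable m).comp measurable_fst
  have hc := measurable_coupledPast h.measurable m
  have hus := (hu.comp_measurable hs).aestronglyMeasurable (μ := P.prod P)
  have huc := (hu.comp_measurable hc).aestronglyMeasurable (μ := P.prod P)
  have hws := (hw.comp_measurable hs).aestronglyMeasurable (μ := P.prod P)
  have hwc := (hw.comp_measurable hc).aestronglyMeasurable (μ := P.prod P)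
  have hwn : eLpNorm (fun q : Ω × Ω => w (past δ m q.1)) 4 (P.prod P)
      = eLpNorm (fun ω => w (past δ 0 ω)) 4 P := by
    rw [← h.eLpNorm_past hw m 0]
    exact eLpNorm_comp_measurePreserving (g := fun ω => w (past δ m ω)) (f := Prod.fst)
      (hw.comp_measurable (measurable_past h.measurable m)).aestronglyMeasurable
      measurePreserving_fst
  have hbil : ∀ {f₁ : Ω × Ω → E₁} {f₂ : Ω × Ω → E₂}, AEStronglyMeasurable f₁ (P.prod P) →
      AEStronglyMeasurable f₂ (P.prod P) →
      eLpNorm (fun q => B (f₁ q) (f₂ q)) 2 (P.prod P)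
        ≤ ‖B‖ₑ * (eLpNorm f₁ 4 (P.prod P) * eLpNorm f₂ 4 (P.prod P)) := fun h1 h2 => by
    rw [← mul_assoc]
    exact eLpNorm_le_eLpNorm_mul_eLpNorm_of_nnnorm h1 h2 (fun a b => B a b) ‖B‖₊
      (Eventually.of_forall fun q => by exact_mod_cast B.le_opNorm₂ _ _)
  rw [← h.eLpNorm_coupledPast hu m, ← hwn]
  simp only [couplingError_eq]
  calc eLpNorm (fun q : Ω × Ω => B (u (past δ m q.1)) (w (past δ m q.1)) - e
        - (B (u (coupledPast δ m q)) (w (coupledPast δ m q)) - e)) 2 (P.prod P)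
      = eLpNorm ((fun q : Ω × Ω =>
          B (u (past δ m q.1) - u (coupledPast δ m q)) (w (past δ m q.1)))
        + fun q => B (u (coupledPast δ m q)) (w (past δ m q.1) - w (coupledPast δ m q))) 2
          (P.prod P) := by
        congr 1
        funext q
        simp only [Pi.add_apply, map_sub, _root_.sub_apply]
        abel
    _ ≤ _ := eLpNorm_add_le
        (B.aestronglyMeasurable_comp₂ (hus.sub huc) hws)
        (B.aestronglyMeasurable_comp₂ huc (hws.sub hwc)) (by norm_num)
    _ ≤ _ := add_le_add (hbil (hus.sub huc) hws) (hbil huc (hws.sub hwc))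

theorem IsIID.tsum_couplingError_bilin_ne_top (h : IsIID P δ) (B : E₁ →L[ℝ] E₂ →L[ℝ] E) (e : E)
    (hu : StronglyMeasurable u) (hw : StronglyMeasurable w)
    (hu4 : MemLp (fun ω => u (past δ 0 ω)) 4 P) (hw4 : MemLp (fun ω => w (past δ 0 ω)) 4 P)
    (hus : ∑' m : ℕ, couplingError P 4 δ u (m + 1) ≠ ⊤)
    (hws : ∑' m : ℕ, couplingError P 4 δ w (m + 1) ≠ ⊤) :
    ∑' m : ℕ, couplingError P 2 δ (fun s => B (u s) (w s) - e) (m + 1) ≠ ⊤ := by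
  refine ne_top_of_le_ne_top ?_ (ENNReal.tsum_le_tsum fun m =>
    h.couplingError_bilin_le B e hu hw (m + 1))
  rw [ENNReal.tsum_add, ENNReal.tsum_mul_left, ENNReal.tsum_mul_right, ENNReal.tsum_mul_left,
    ENNReal.tsum_mul_left]
  exact ENNReal.add_ne_top.2 ⟨ENNReal.mul_ne_top (by simp) (ENNReal.mul_ne_top hus hw4.2.ne),
    ENNReal.mul_ne_top (by simp) (ENNReal.mul_ne_top hu4.2.ne hws)⟩

end Coupling

/-! ### Second moment operators and the support of a random element -/

section SecondMomentOperator

variable {Ω : Type*} [MeasurableSpace Ω] {P : Measure Ω}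
  {H₁ H₂ : Type*} [NormedAddCommGroup H₁] [InnerProductSpace ℝ H₁]
  [NormedAddCommGroup H₂] [InnerProductSpace ℝ H₂]

theorem integrable_tensor {X : Ω → H₁} {Y : Ω → H₂} (hX : MemLp X 2 P) (hY : MemLp Y 2 P) :
    Integrable (fun ω => tensor (X ω) (Y ω)) P := by
  have hm : AEStronglyMeasurable (fun ω => tensor (X ω) (Y ω)) P :=
    (ContinuousLinearMap.smulRightL ℝ H₁ H₂).aestronglyMeasurable_comp₂
      ((innerSL ℝ).continuous.comp_aestronglyMeasurable hX.1) hY.1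
  refine (hX.norm.integrable_mul hY.norm).mono hm (Eventually.of_forall fun ω => ?_)
  rw [tensor, InnerProductSpace.norm_rankOne, Pi.mul_apply, norm_mul, norm_norm, norm_norm,
    mul_comm]

variable [CompleteSpace H₂]

theorem inner_integral_tensor {X : Ω → H₁} {Y : Ω → H₂} (hX : MemLp X 2 P) (hY : MemLp Y 2 P)
    (x : H₁) (y : H₂) :
    inner ℝ y ((∫ ω, tensor (X ω) (Y ω) ∂P) x)
      = ∫ ω, inner ℝ x (X ω) * inner ℝ y (Y ω) ∂P := by
  have hi := integrable_tensor hX hY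
  rw [ContinuousLinearMap.integral_apply hi, ← integral_inner (hi.apply_continuousLinearMap x)]
  refine integral_congr_ae (Eventually.of_forall fun ω => ?_)
  simp only [tensor_apply, inner_smul_right, real_inner_comm]

end SecondMomentOperator

section Support

variable {Ω : Type*} [MeasurableSpace Ω] {P : Measure Ω}
  {H : Type*} [NormedAddCommGroup H] [InnerProductSpace ℝ H] [CompleteSpace H]
  {X : Ω → H}

/-- The quadratic form at `d` equals the expectation of `⟨d, X⟩²`. -/
theorem ae_inner_eq_zero_of_inner_eq_zero (hX : MemLp X 2 P) {d : H}
    (hd : inner ℝ d ((∫ ω, tensor (X ω) (X ω) ∂P) d) = 0) : ∀ᵐ ω ∂P, inner ℝ d (X ω) = 0 := by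
  rw [inner_integral_tensor hX hX] at hd
  have hi : Integrable (fun ω => inner ℝ d (X ω) * inner ℝ d (X ω)) P :=
    (hX.const_inner d).integrable_mul (hX.const_inner d)
  rw [integral_eq_zero_iff_of_nonneg (fun ω => mul_self_nonneg _) hi] at hd
  filter_upwards [hd] with ω hω
  simpa using hω

variable [SecondCountableTopology H]

/-- The quadratic form vanishes on the orthogonal complement of the range, so `X` is almost surely
orthogonal to a countable dense subset of that complement, hence to all of it. -/
theorem ae_mem_closure_range (hX : MemLp X 2 P) :
    ∀ᵐ ω ∂P, X ω ∈ closure (Set.range fun d => (∫ ω, tensor (X ω) (X ω) ∂P) d) := by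
  set C := ∫ ω, tensor (X ω) (X ω) ∂P with hC
  set K := (LinearMap.range (C : H →ₗ[ℝ] H))ᗮ with hK
  have h1 : ∀ i, ∀ᵐ ω ∂P, inner ℝ ((TopologicalSpace.denseSeq K i : K) : H) (X ω) = 0 := fun i =>
    ae_inner_eq_zero_of_inner_eq_zero hX (by
      rw [real_inner_comm]
      exact Submodule.inner_right_of_mem_orthogonal (LinearMap.mem_range_self _ _)
        (TopologicalSpace.denseSeq K i).2)
  filter_upwards [ae_all_iff.2 h1] with ω hω
  have h2 : ∀ d : K, inner ℝ (d : H) (X ω) = 0 := by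
    have := (TopologicalSpace.denseRange_denseSeq K).equalizer
      (g := fun d : K => inner ℝ (d : H) (X ω)) (h := fun _ => 0) (by fun_prop) (by fun_prop)
      (funext hω)
    exact fun d => congrFun this d
  have h3 : X ω ∈ Kᗮ := (Submodule.mem_orthogonal _ _).2 fun d hd => h2 ⟨d, hd⟩
  rw [hK, Submodule.orthogonal_orthogonal_eq_closure] at h3
  exact h3

/-- Take the first `N` points of a dense sequence; the bad events decrease in `N` to a null set. -/
theorem exists_finset_measure_le [IsProbabilityMeasure P] (hX : MemLp X 2 P) {ρ : ℝ} (hρ : 0 < ρ) {η : ENNReal}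
    (hη : 0 < η) :
    ∃ D : Finset H, P {ω | ∀ d ∈ D, ρ ≤ ‖X ω - (∫ ω, tensor (X ω) (X ω) ∂P) d‖} ≤ η := by
  classical
  set C := ∫ ω, tensor (X ω) (X ω) ∂P with hC
  set d := TopologicalSpace.denseSeq H with hd
  set A : ℕ → Set Ω := fun N => {ω | ∀ i < N, ρ ≤ ‖X ω - C (d i)‖} with hA
  have hmeas : ∀ N, NullMeasurableSet (A N) P := fun N => by
    have : A N = ⋂ i ∈ Finset.range N, {ω | ρ ≤ ‖X ω - C (d i)‖} := by ext; simp [hA]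
    rw [this]
    exact Finset.nullMeasurableSet_biInter _ fun i _ => nullMeasurableSet_le aemeasurable_const
      (hX.1.sub aestronglyMeasurable_const).norm.aemeasurable
  have hanti : Antitone A := fun M N hMN ω hω i hi => hω i (hi.trans_le hMN)
  have hlim := tendsto_measure_iInter_atTop hmeas hanti ⟨0, measure_ne_top P _⟩
  have hzero : P (⋂ N, A N) = 0 := by
    refine measure_mono_null (t := {ω | ¬ X ω ∈ closure (Set.range fun d => C d)}) ?_
      (ae_iff.1 (ae_mem_closure_range hX))
    intro ω hω hcl
    obtain ⟨_, ⟨z, rfl⟩, hz⟩ := Metric.mem_closure_iff.1 hcl ρ hρ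
    have hopen : IsOpen {z | dist (X ω) (C z) < ρ} :=
      isOpen_lt (continuous_const.dist C.continuous) continuous_const
    obtain ⟨_, hi, ⟨i, rfl⟩⟩ := (TopologicalSpace.denseRange_denseSeq H).exists_mem_open hopen ⟨z, hz⟩
      |>.elim fun i hi => (⟨_, hi, i, rfl⟩ :
        ∃ y, y ∈ {z | dist (X ω) (C z) < ρ} ∧ ∃ i, TopologicalSpace.denseSeq H i = y)
    have h1 := Set.mem_iInter.1 hω (i + 1) i (Nat.lt_succ_self i)
    rw [Set.mem_ofPred_eq, dist_eq_norm] at hi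
    exact absurd h1 (not_le.2 hi)
  rw [hzero] at hlim
  obtain ⟨N, hN⟩ := (hlim.eventually (ge_mem_nhds hη)).exists
  refine ⟨(Finset.range N).image d, le_trans (measure_mono (t := A N) ?_) hN⟩
  intro ω hω i hi
  exact hω _ (Finset.mem_image_of_mem _ (Finset.mem_range.2 hi))

end Support

/-! ### Mean square rates for the empirical operators -/

section Consistency

variable {Ω : Type*} [MeasurableSpace Ω] {P : Measure Ω} [IsProbabilityMeasure P]

theorem tendsto_measure_ge_zero {g : ℕ → Ω → ℝ} {b : ℕ → ℝ} (h0 : ∀ᶠ n in atTop, 0 ≤ᵐ[P] g n)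
    (hi : ∀ᶠ n in atTop, Integrable (g n) P) (hb : ∀ᶠ n in atTop, ∫ ω, g n ω ∂P ≤ b n)
    (hlim : Tendsto b atTop (𝓝 0)) {ρ : ℝ} (hρ : 0 < ρ) :
    Tendsto (fun n => P {ω | ρ ≤ g n ω}) atTop (𝓝 0) := by
  have hlim' : Tendsto (fun n => ENNReal.ofReal (b n / ρ)) atTop (𝓝 0) := by
    have := ENNReal.tendsto_ofReal (hlim.div_const ρ)
    simpa using this
  refine tendsto_of_tendsto_of_tendsto_of_le_of_le' tendsto_const_nhds hlim'
    (Eventually.of_forall fun _ => zero_le) ?_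
  filter_upwards [h0, hi, hb] with n h0 hi hb
  rw [← ENNReal.ofReal_toReal (measure_ne_top P {ω | ρ ≤ g n ω})]
  refine ENNReal.ofReal_le_ofReal ?_
  rw [le_div_iff₀ hρ, mul_comm]
  exact (mul_meas_ge_le_integral_of_nonneg h0 hi ρ).trans hb

variable {S : Type*} [MeasurableSpace S] {δ : ℤ → Ω → S}
  {H : Type*} [NormedAddCommGroup H] [InnerProductSpace ℝ H] [CompleteSpace H]
  {f : (ℕ → S) → H} {X : ℕ → Ω → H}

/-- The empirical covariance operator converges pointwise at rate `n^{-1/2}` in mean square. -/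
theorem IsIID.exists_integral_empiricalOperator_sub_le (h : IsIID P δ)
    (hf : StronglyMeasurable f) (hf4 : MemLp (fun ω => f (past δ 0 ω)) 4 P)
    (hsum : ∑' m : ℕ, couplingError P 4 δ f (m + 1) ≠ ⊤)
    (hX : ∀ n : ℕ, 1 ≤ n → X n =ᵐ[P] fun ω => f (past δ n ω)) (d : H) :
    ∃ c : ℝ, ∀ n : ℕ, 1 ≤ n →
      Integrable (fun ω => ‖empiricalOperator n (fun k => X k ω) (fun k => X k ω) d
        - (∫ ω, tensor (f (past δ 0 ω)) (f (past δ 0 ω)) ∂P) d‖ ^ 2) P ∧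
      ∫ ω, ‖empiricalOperator n (fun k => X k ω) (fun k => X k ω) d
        - (∫ ω, tensor (f (past δ 0 ω)) (f (past δ 0 ω)) ∂P) d‖ ^ 2 ∂P ≤ c * (n : ℝ)⁻¹ := by
  have hf2 : MemLp (fun ω => f (past δ 0 ω)) 2 P := hf4.mono_exponent (by norm_num)
  set e := (∫ ω, tensor (f (past δ 0 ω)) (f (past δ 0 ω)) ∂P) d with he
  -- With this bilinear map the estimation error at `d` is the average of the centred stationary
  -- terms `F`.
  set B : H →L[ℝ] H →L[ℝ] H := (innerSL ℝ d).smulRight (ContinuousLinearMap.id ℝ H) with hB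
  have hBa : ∀ x y, B x y = inner ℝ d x • y := fun x y => by simp [hB]
  set F : (ℕ → S) → H := fun s => B (f s) (f s) - e with hF
  have hFm : StronglyMeasurable F :=
    ((B.continuous₂.comp_stronglyMeasurable (hf.prodMk hf))).sub stronglyMeasurable_const
  have hF2 : MemLp (fun ω => F (past δ 0 ω)) 2 P := memLp_bilin_past B e hf4 hf4
  have hF0 : ∀ b, ∫ ω, inner ℝ b (F (past δ 0 ω)) ∂P = 0 := fun b => by
    have hi : Integrable (fun ω => inner ℝ d (f (past δ 0 ω)) * inner ℝ b (f (past δ 0 ω))) P :=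
      (hf2.const_inner d).integrable_mul (hf2.const_inner b)
    simp only [hF, hBa, inner_sub_right, inner_smul_right]
    rw [integral_sub hi (integrable_const _), ← inner_integral_tensor hf2 hf2, he]
    simp
  obtain ⟨c, -, hc⟩ := h.exists_integral_norm_sq_sum_le hFm hF2 hF0
    (h.tsum_couplingError_bilin_ne_top B e hf hf hf4 hf4 hsum hsum) 1
  refine ⟨c, fun n hn => ?_⟩
  have hn0 : (n : ℝ) ≠ 0 := by positivity
  have hae : (fun ω => ‖empiricalOperator n (fun k => X k ω) (fun k => X k ω) d - e‖ ^ 2)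
      =ᵐ[P] fun ω => (n : ℝ)⁻¹ ^ 2 * ‖∑ k ∈ Finset.range n, F (past δ (k + 1) ω)‖ ^ 2 := by
    have hall : ∀ᵐ ω ∂P, ∀ k : ℕ, 1 ≤ k → X k ω = f (past δ k ω) :=
      ae_all_iff.2 fun k => by
        by_cases hk : 1 ≤ k
        · filter_upwards [hX k hk] with ω hω _ using hω
        · exact Eventually.of_forall fun ω hk' => absurd hk' hk
    filter_upwards [hall] with ω hω
    have h1 : empiricalOperator n (fun k => X k ω) (fun k => X k ω) d - e
        = (n : ℝ)⁻¹ • ∑ k ∈ Finset.range n, F (past δ (k + 1) ω) := by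
      rw [empiricalOperator_apply, hF, Finset.sum_sub_distrib, smul_sub, Finset.sum_const,
        Finset.card_range, ← Nat.cast_smul_eq_nsmul ℝ, smul_smul, inv_mul_cancel₀ hn0, one_smul,
        Finset.range_eq_Ico,
        ← zero_add 1, ← Finset.Ico_add_one_right_eq_Icc,
        ← Finset.sum_Ico_add' (fun k => inner ℝ (X k ω) d • X k ω)]
      congr 2
      refine Finset.sum_congr rfl fun k _ => ?_
      rw [hω _ (by omega), hBa, real_inner_comm]
      push_cast
      rfl
    rw [h1, norm_smul, mul_pow, norm_inv, Real.norm_natCast]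
  have hint : Integrable (fun ω => ‖∑ k ∈ Finset.range n, F (past δ (k + 1) ω)‖ ^ 2) P :=
    (memLp_finsetSum _ fun k _ => h.memLp_past hFm hF2 _).integrable_norm_pow (by norm_num)
  refine ⟨(hint.const_mul _).congr hae.symm, ?_⟩
  rw [integral_congr_ae hae, integral_const_mul]
  calc (n : ℝ)⁻¹ ^ 2 * ∫ ω, ‖∑ k ∈ Finset.range n, F (past δ (k + 1) ω)‖ ^ 2 ∂P
      ≤ (n : ℝ)⁻¹ ^ 2 * (c * n) := by gcongr; exact hc n
    _ = c * (n : ℝ)⁻¹ := by field_simp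

/-- The empirical cross covariance of an approximable sequence and the errors of its one-step
linear prediction has second moments of order `n`. -/
theorem IsIID.exists_integral_sum_tmul_le (h : IsIID P δ)
    (hf : StronglyMeasurable f) (hf4 : MemLp (fun ω => f (past δ 0 ω)) 4 P)
    (hsum : ∑' m : ℕ, couplingError P 4 δ f (m + 1) ≠ ⊤)
    (hX : ∀ n : ℕ, 1 ≤ n → X n =ᵐ[P] fun ω => f (past δ n ω)) (Ψ : H →L[ℝ] H) {e : ℕ → Ω → H}
    (he : ∀ n, 1 ≤ n → ∀ᵐ ω ∂P, X (n + 1) ω = Ψ (X n ω) + e n ω)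
    (horth : Orthogonal P (X 1) (e 1)) :
    ∃ c : ℝ, ∀ n : ℕ,
      Integrable (fun ω => ‖∑ k ∈ Finset.Icc 1 n, X k ω ⊗ₜ[ℝ] e k ω‖ ^ 2) P ∧
      ∫ ω, ‖∑ k ∈ Finset.Icc 1 n, X k ω ⊗ₜ[ℝ] e k ω‖ ^ 2 ∂P ≤ c * n := by
  -- Evaluated at the past of time `k + 1`, `u` gives `X_k` and `w` gives the error `e_k`.
  set u : (ℕ → S) → H := fun s => f fun j => s (j + 1) with hu
  set w : (ℕ → S) → H := fun s => f s - Ψ (u s) with hw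
  have hum : StronglyMeasurable u := hf.comp_measurable (by fun_prop)
  have hwm : StronglyMeasurable w := hf.sub (Ψ.continuous.comp_stronglyMeasurable hum)
  have hup : ∀ (k : ℤ) ω, u (past δ (k + 1) ω) = f (past δ k ω) := fun k ω => by
    rw [hu]; simp only [past_tail]
  have hu4 : MemLp (fun ω => u (past δ 0 ω)) 4 P := by
    have := h.memLp_past hf hf4 (-1)
    simpa [← hup] using this
  have hw4 : MemLp (fun ω => w (past δ 0 ω)) 4 P := hf4.sub (Ψ.comp_memLp' hu4)
  have hus : ∑' m : ℕ, couplingError P 4 δ u (m + 1) ≠ ⊤ := by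
    simp only [hu, couplingError_tail]
    rw [tsum_eq_zero_add' ENNReal.summable]
    exact ENNReal.add_ne_top.2 ⟨h.couplingError_ne_top hf hf4 0, hsum⟩
  have hws : ∑' m : ℕ, couplingError P 4 δ w (m + 1) ≠ ⊤ := by
    refine ne_top_of_le_ne_top ?_ (ENNReal.tsum_le_tsum fun m =>
      h.couplingError_sub_clm_le (by norm_num) hf hum Ψ (m + 1))
    rw [ENNReal.tsum_add, ENNReal.tsum_mul_left]
    exact ENNReal.add_ne_top.2 ⟨hsum, ENNReal.mul_ne_top (by simp) hus⟩
  have hXe : ∀ᵐ ω ∂P, ∀ k : ℕ, 1 ≤ k →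
      X k ω = u (past δ (k + 1) ω) ∧ e k ω = w (past δ (k + 1) ω) :=
    ae_all_iff.2 fun k => by
      by_cases hk : 1 ≤ k
      · filter_upwards [hX k hk, hX (k + 1) (by omega), he k hk] with ω h1 h2 h3 _
        push_cast at h2
        refine ⟨by rw [h1, hup], ?_⟩
        simp only [hw]
        rw [hup, ← h1, ← h2, h3, add_sub_cancel_left]
      · exact Eventually.of_forall fun ω hk' => absurd hk' hk
  set B := TensorProduct.mkL ℝ H H with hB
  set F : (ℕ → S) → TensorProduct ℝ H H := fun s => B (u s) (w s) - 0 with hF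
  have hFm : StronglyMeasurable F :=
    (B.continuous₂.comp_stronglyMeasurable (hum.prodMk hwm)).sub stronglyMeasurable_const
  have hF2 : MemLp (fun ω => F (past δ 0 ω)) 2 P := memLp_bilin_past B 0 hu4 hw4
  have hF0 : ∀ b, ∫ ω, inner ℝ b (F (past δ 0 ω)) ∂P = 0 := fun b => by
    have hFb : ∀ b, Integrable (fun ω => inner ℝ b (F (past δ 0 ω))) P := fun b =>
      (hF2.const_inner b).integrable (by norm_num)
    induction b with
    | zero => simp
    | add b₁ b₂ h1 h2 =>
      simp only [inner_add_left]
      rw [integral_add (hFb b₁) (hFb b₂), h1, h2, add_zero]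
    | tmul x y =>
      have hG : Measurable fun s : ℕ → S => inner ℝ (x ⊗ₜ[ℝ] y) (F s) :=
        (stronglyMeasurable_const.inner hFm).measurable
      -- The past at time `2` carries the pair `(X_1, e_1)`, so orthogonality at the single index
      -- `1` centres the whole stationary sequence.
      have h1 := ((h.identDistrib_past 0 2).comp hG).integral_eq
      simp only [Function.comp_def] at h1
      have h2 := inner_integral_tensor horth.1 horth.2.1 x y
      rw [horth.2.2, _root_.zero_apply, inner_zero_right] at h2
      rw [h1, h2]
      refine integral_congr_ae ?_
      filter_upwards [hXe] with ω hω
      obtain ⟨h3, h4⟩ := hω 1 le_rfl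
      norm_num at h3 h4
      rw [h3, h4]
      simp [hF, hB, TensorProduct.mkL_apply_apply]
  obtain ⟨c, -, hc⟩ := h.exists_integral_norm_sq_sum_le hFm hF2 hF0
    (h.tsum_couplingError_bilin_ne_top B 0 hum hwm hu4 hw4 hus hws) 2
  refine ⟨c, fun n => ?_⟩
  have hae : (fun ω => ‖∑ k ∈ Finset.Icc 1 n, X k ω ⊗ₜ[ℝ] e k ω‖ ^ 2)
      =ᵐ[P] fun ω => ‖∑ k ∈ Finset.range n, F (past δ (k + 2) ω)‖ ^ 2 := by
    filter_upwards [hXe] with ω hω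
    congr 2
    rw [Finset.range_eq_Ico, ← zero_add 1, ← Finset.Ico_add_one_right_eq_Icc,
        ← Finset.sum_Ico_add' (fun k => X k ω ⊗ₜ[ℝ] e k ω)]
    refine Finset.sum_congr rfl fun k _ => ?_
    obtain ⟨h3, h4⟩ := hω (k + 1) (by omega)
    rw [h3, h4]
    push_cast
    simp only [hF, hB, TensorProduct.mkL_apply_apply, sub_zero, add_assoc]
    norm_num
  have hint : Integrable (fun ω => ‖∑ k ∈ Finset.range n, F (past δ (k + 2) ω)‖ ^ 2) P :=
    (memLp_finsetSum _ fun k _ => h.memLp_past hFm hF2 _).integrable_norm_pow (by norm_num)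
  refine ⟨hint.congr hae.symm, ?_⟩
  rw [integral_congr_ae hae]
  exact hc n

end Consistency

/-! ### Consistency in probability of the predictor -/

section Prediction

/-- The perturbation changes the quadratic form at `d` by less than `κ / 2`, so at least half of `κ`
remains in the Rayleigh quotient bounded by `lam 1`. -/
theorem IsEigensystem.le_of_norm_apply_sub_lt {H : Type*} [NormedAddCommGroup H]
    [InnerProductSpace ℝ H] {T C : H →L[ℝ] H} {lam : ℕ → ℝ} {v : ℕ → H}
    (h : IsEigensystem T lam v) {d : H} {κ : ℝ} (hd : d ≠ 0) (hκ : κ = inner ℝ (C d) d)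
    (hlt : ‖T d - C d‖ < κ / (2 * ‖d‖)) : κ / (2 * ‖d‖ ^ 2) ≤ lam 1 := by
  have hd0 : 0 < ‖d‖ := norm_pos_iff.2 hd
  have h1 := h.inner_apply_le d
  have h2 : inner ℝ (T d) d = κ + inner ℝ (T d - C d) d := by rw [inner_sub_left, hκ]; ring
  have h3 := (abs_le.1 (abs_real_inner_le_norm (T d - C d) d)).1
  rw [lt_div_iff₀ (by positivity)] at hlt
  rw [div_le_iff₀ (by positivity)]
  nlinarith

variable {Ω : Type*} [MeasurableSpace Ω] {P : Measure Ω} [IsProbabilityMeasure P]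
  {H : Type*} [NormedAddCommGroup H] [InnerProductSpace ℝ H] [CompleteSpace H]
  [SecondCountableTopology H] [MeasurableSpace H] [BorelSpace H]

theorem tendstoInMeasure_prediction (Ψ : H →L[ℝ] H) (hΨ : ‖Ψ‖ ≤ 1) {X e : ℕ → Ω → H}
    (hrec : ∀ n, 1 ≤ n → ∀ᵐ ω ∂P, X (n + 1) ω = Ψ (X n ω) + e n ω)
    (hX : IsLpMApproximable P 4 X) (horth : Orthogonal P (X 1) (e 1))
    {m : ℕ → ℝ} (hm : Tendsto m atTop atTop)
    (hmo : m =o[atTop] (fun n : ℕ => Real.sqrt n))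
    {lam : ℕ → Ω → ℕ → ℝ} {v : ℕ → Ω → ℕ → H}
    (heig : ∀ n, 1 ≤ n → ∀ ω, IsEigensystem
        (empiricalOperator n (fun k => X k ω) (fun k => X k ω)) (lam n ω) (v n ω)) :
    TendstoInMeasure P
      (fun n ω => ‖Ψ (X n ω) - pcEstimator n (truncationLevel n (m n) (lam n ω))
          (fun k => X k ω) (fun k => X (k + 1) ω) (lam n ω) (v n ω) (X n ω)‖)
      atTop (fun _ => (0 : ℝ)) := by
  obtain ⟨hX4, S, _, δ, f, hδm, hδi, hδd, hfm, hXf, hsum⟩ := hX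
  have h : IsIID P δ := ⟨hδm, hδi, hδd⟩
  replace hXf : ∀ n : ℕ, 1 ≤ n → X n =ᵐ[P] fun ω => f (past δ n ω) := hXf
  have hf : StronglyMeasurable f := hfm.stronglyMeasurable
  have hf4 : MemLp (fun ω => f (past δ 0 ω)) 4 P :=
    h.memLp_past hf ((memLp_congr_ae (hXf 1 le_rfl)).1 (hX4 1 le_rfl)) 0
  have hf2 : MemLp (fun ω => f (past δ 0 ω)) 2 P := hf4.mono_exponent (by norm_num)
  have hX2 : ∀ n, 1 ≤ n → MemLp (X n) 2 P := fun n hn => (hX4 n hn).mono_exponent (by norm_num)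
  set C := ∫ ω, tensor (f (past δ 0 ω)) (f (past δ 0 ω)) ∂P with hC
  have hid : ∀ n, 1 ≤ n → IdentDistrib (X n) (fun ω => f (past δ 0 ω)) P P := fun n hn =>
    (IdentDistrib.of_ae_eq (hX4 n hn).1.aemeasurable (hXf n hn)).trans
      ((h.identDistrib_past n 0).comp hfm)
  have hrec' : ∀ᵐ ω ∂P, ∀ k : ℕ, 1 ≤ k → X (k + 1) ω = Ψ (X k ω) + e k ω :=
    ae_all_iff.2 fun k => by
      by_cases hk : 1 ≤ k
      · filter_upwards [hrec k hk] with ω hω _ using hω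
      · exact Eventually.of_forall fun ω hk' => absurd hk' hk
  rw [tendstoInMeasure_iff_norm]
  intro ε hε
  simp only [sub_zero, norm_norm]
  -- In the degenerate case the observations vanish almost surely and so does the error; otherwise
  -- some `d₀` yields a lower bound for the top eigenvalue.
  by_cases hC0 : ∀ d, inner ℝ (C d) d = 0
  · have hCz : ∀ d, C d = 0 := fun d => by
      have h1 := ae_inner_eq_zero_of_inner_eq_zero hf2 (d := d) (by rw [real_inner_comm]; exact hC0 d)
      refine ext_inner_left ℝ fun b => ?_
      rw [hC, inner_integral_tensor hf2 hf2, inner_zero_right]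
      refine integral_eq_zero_of_ae ?_
      filter_upwards [h1] with ω hω
      simp [hω]
    have hf0 : ∀ᵐ ω ∂P, f (past δ 0 ω) = 0 := by
      filter_upwards [ae_mem_closure_range hf2] with ω hω
      rw [← hC] at hω
      simpa [hCz] using hω
    refine tendsto_const_nhds.congr' ?_
    filter_upwards [eventually_ge_atTop 1] with n hn
    have hXn : ∀ᵐ ω ∂P, X n ω ∈ ({0} : Set H) :=
      (hid n hn).symm.ae_mem_snd (measurableSet_singleton 0) hf0
    symm
    rw [← nonpos_iff_eq_zero, ← measure_empty (μ := P)]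
    refine measure_mono_ae ?_
    filter_upwards [hXn] with ω hω hbad
    rw [Set.mem_singleton_iff] at hω
    have : ε ≤ ‖Ψ (X n ω) - pcEstimator n (truncationLevel n (m n) (lam n ω))
          (fun k => X k ω) (fun k => X (k + 1) ω) (lam n ω) (v n ω) (X n ω)‖ := hbad
    rw [hω, pcEstimator_zero, map_zero, sub_zero, norm_zero] at this
    exact absurd hε (not_lt.2 this)
  push Not at hC0
  obtain ⟨d₀, hd₀⟩ := hC0
  set κ := inner ℝ (C d₀) d₀ with hκ
  have hκ0 : 0 < κ := by
    refine lt_of_le_of_ne ?_ (Ne.symm hd₀)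
    rw [hκ, real_inner_comm, hC, inner_integral_tensor hf2 hf2]
    exact integral_nonneg fun ω => mul_self_nonneg _
  have hd0 : d₀ ≠ 0 := by
    rintro rfl
    simp [hκ] at hd₀
  have hd0' : 0 < ‖d₀‖ := norm_pos_iff.2 hd0
  set β := κ / (2 * ‖d₀‖ ^ 2) with hβ
  have hβ0 : 0 < β := by positivity
  set σ := ∫ ω, ‖f (past δ 0 ω)‖ ^ 2 ∂P with hσ
  have hXi : ∀ n, 1 ≤ n → Integrable (fun ω => ‖X n ω‖ ^ 2) P := fun n hn =>
    (hX2 n hn).integrable_norm_pow (by norm_num)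
  have hXσ : ∀ n, 1 ≤ n → ∫ ω, ‖X n ω‖ ^ 2 ∂P = σ := fun n hn =>
    ((hid n hn).norm.pow (n := 2)).integral_eq
  have hinv : Tendsto (fun n : ℕ => (n : ℝ)⁻¹) atTop (𝓝 0) := tendsto_inv_atTop_nhds_zero_nat
  set R : H → ℕ → Ω → ℝ := fun d n ω =>
    ‖empiricalOperator n (fun k => X k ω) (fun k => X k ω) d - C d‖ with hR
  have tR : ∀ d, ∀ ρ, 0 < ρ → Tendsto (fun n => P {ω | ρ ≤ R d n ω}) atTop (𝓝 0) := by
    intro d ρ hρ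
    obtain ⟨c, hc⟩ := h.exists_integral_empiricalOperator_sub_le hf hf4 hsum hXf d
    have h1 := tendsto_measure_ge_zero (P := P) (g := fun n ω => R d n ω ^ 2)
      (b := fun n => c * (n : ℝ)⁻¹) (Eventually.of_forall fun n => ae_of_all _ fun ω => sq_nonneg _)
      (by filter_upwards [eventually_ge_atTop 1] with n hn using (hc n hn).1)
      (by filter_upwards [eventually_ge_atTop 1] with n hn using (hc n hn).2)
      (by simpa using hinv.const_mul c) (ρ := ρ ^ 2) (by positivity)
    refine tendsto_of_tendsto_of_tendsto_of_le_of_le tendsto_const_nhds h1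
      (fun _ => zero_le) fun n => measure_mono ?_
    intro ω (hω : ρ ≤ R d n ω)
    exact pow_le_pow_left₀ hρ.le hω 2
  -- Dominates the truncation term `λ_1 / m * ‖d‖`, with `λ_1` replaced by the trace.
  set Q : H → ℕ → Ω → ℝ := fun d n ω =>
    (m n)⁻¹ * ‖d‖ * ((n : ℝ)⁻¹ * ∑ k ∈ Finset.Icc 1 n, ‖X k ω‖ ^ 2) with hQ
  have tQ : ∀ d, ∀ ρ, 0 < ρ → Tendsto (fun n => P {ω | ρ ≤ Q d n ω}) atTop (𝓝 0) := by
    intro d ρ hρ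
    have hsi : ∀ n : ℕ, Integrable (fun ω => ∑ k ∈ Finset.Icc 1 n, ‖X k ω‖ ^ 2) P := fun n =>
      integrable_finsetSum _ fun k hk => hXi k (Finset.mem_Icc.1 hk).1
    refine tendsto_measure_ge_zero (b := fun n => (m n)⁻¹ * ‖d‖ * σ) ?_ ?_ ?_ ?_ hρ
    · filter_upwards [hm.eventually_gt_atTop 0] with n hn
      exact ae_of_all _ fun ω => by simp only [hQ, Pi.zero_apply]; positivity
    · exact Eventually.of_forall fun n => ((hsi n).const_mul _).const_mul _
    · filter_upwards [eventually_ge_atTop 1] with n hn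
      have hn0 : (n : ℝ) ≠ 0 := by positivity
      simp only [hQ]
      rw [integral_const_mul, integral_const_mul,
        integral_finsetSum _ fun k hk => hXi k (Finset.mem_Icc.1 hk).1,
        Finset.sum_congr rfl fun k hk => hXσ k (Finset.mem_Icc.1 hk).1]
      simp [hn0]
    · simpa using ((tendsto_inv_atTop_zero.comp hm).mul_const ‖d‖).mul_const σ
  -- Dominates the noise term when `λ_1 ≥ β`: the product of the noise norm and `‖X_n‖` is split by
  -- `2ab ≤ a² + b²`, so only second moments are needed.
  set L : ℕ → Ω → ℝ := fun n ω => m n / Real.sqrt n * (2 * β)⁻¹ *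
    ((n : ℝ)⁻¹ * ‖∑ k ∈ Finset.Icc 1 n, X k ω ⊗ₜ[ℝ] e k ω‖ ^ 2 + ‖X n ω‖ ^ 2) with hL
  have tL : ∀ ρ, 0 < ρ → Tendsto (fun n => P {ω | ρ ≤ L n ω}) atTop (𝓝 0) := by
    intro ρ hρ
    obtain ⟨c, hc⟩ := h.exists_integral_sum_tmul_le hf hf4 hsum hXf Ψ hrec horth
    refine tendsto_measure_ge_zero (b := fun n => m n / Real.sqrt n * (2 * β)⁻¹ * (c + σ))
      ?_ ?_ ?_ ?_ hρ
    · filter_upwards [hm.eventually_gt_atTop 0] with n hn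
      exact ae_of_all _ fun ω => by simp only [hL, Pi.zero_apply]; positivity
    · filter_upwards [eventually_ge_atTop 1] with n hn
      exact (((hc n).1.const_mul _).add (hXi n hn)).const_mul _
    · filter_upwards [eventually_ge_atTop 1, hm.eventually_gt_atTop 0] with n hn hmn
      have hn0 : (n : ℝ) ≠ 0 := by positivity
      simp only [hL]
      rw [integral_const_mul, integral_add ((hc n).1.const_mul _) (hXi n hn), integral_const_mul,
        hXσ n hn]
      gcongr
      calc (n : ℝ)⁻¹ * _ ≤ (n : ℝ)⁻¹ * (c * n) := by gcongr; exact (hc n).2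
        _ = c := by field_simp
    · simpa using (hmo.tendsto_div_nhds_zero.mul_const (2 * β)⁻¹).mul_const (c + σ)
  rw [ENNReal.tendsto_nhds_zero]
  intro η hη
  obtain ⟨D, hD⟩ := exists_finset_measure_le hf2 (ρ := ε / 4) (by positivity)
    (η := η / 2) (ENNReal.half_pos hη.ne')
  have hrest : Tendsto (fun n => (∑ d ∈ D, (P {ω | ε / 4 ≤ R d n ω} + P {ω | ε / 4 ≤ Q d n ω}))
      + P {ω | κ / (2 * ‖d₀‖) ≤ R d₀ n ω} + P {ω | ε / 4 ≤ L n ω}) atTop (𝓝 0) := by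
    have h1 : Tendsto (fun n => ∑ d ∈ D,
        (P {ω | ε / 4 ≤ R d n ω} + P {ω | ε / 4 ≤ Q d n ω})) atTop (𝓝 0) := by
      have := tendsto_finsetSum D fun d _ =>
        (tR d (ε / 4) (by positivity)).add (tQ d (ε / 4) (by positivity))
      simpa using this
    simpa using (h1.add (tR d₀ (κ / (2 * ‖d₀‖)) (by positivity))).add (tL (ε / 4) (by positivity))
  filter_upwards [(ENNReal.tendsto_nhds_zero.1 hrest) (η / 2) (ENNReal.half_pos hη.ne'),
    eventually_ge_atTop 1, hm.eventually_gt_atTop 0] with n hn hn1 hmn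
  have hA : P {ω | ∀ d ∈ D, ε / 4 ≤ ‖X n ω - C d‖} ≤ η / 2 := by
    have hcl : IsClosed {x : H | ∀ d ∈ D, ε / 4 ≤ ‖x - C d‖} := by
      have : {x : H | ∀ d ∈ D, ε / 4 ≤ ‖x - C d‖} = ⋂ d ∈ D, {x | ε / 4 ≤ ‖x - C d‖} := by
        ext; simp
      rw [this]
      exact isClosed_biInter fun d _ => isClosed_le continuous_const (by fun_prop)
    exact ((hid n hn1).measure_mem_eq hcl.measurableSet).trans_le hD
  -- Off `U`, each of the four terms in the deterministic bound is below `ε / 4` for some `d ∈ D`,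
  -- and `λ_1 ≥ β`.
  set U := {ω | ∀ d ∈ D, ε / 4 ≤ ‖X n ω - C d‖} ∪
    ((⋃ d ∈ D, ({ω | ε / 4 ≤ R d n ω} ∪ {ω | ε / 4 ≤ Q d n ω})) ∪
      {ω | κ / (2 * ‖d₀‖) ≤ R d₀ n ω} ∪ {ω | ε / 4 ≤ L n ω}) with hU
  have hPU : P U ≤ η := by
    refine (measure_union_le _ _).trans ((add_le_add hA ?_).trans_eq (ENNReal.add_halves η))
    refine le_trans ?_ hn
    refine (measure_union_le _ _).trans (add_le_add ((measure_union_le _ _).trans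
      (add_le_add ?_ le_rfl)) le_rfl)
    exact (measure_biUnion_finset_le _ _).trans
      (Finset.sum_le_sum fun d _ => measure_union_le _ _)
  refine le_trans (measure_mono_ae ?_) hPU
  filter_upwards [hrec'] with ω hω hbad
  have hbad' : ε ≤ ‖Ψ (X n ω) - pcEstimator n (truncationLevel n (m n) (lam n ω))
    (fun k => X k ω) (fun k => X (k + 1) ω) (lam n ω) (v n ω) (X n ω)‖ := hbad
  change ω ∈ U
  by_contra hnot
  have hU' : ¬((∀ d ∈ D, ε / 4 ≤ ‖X n ω - C d‖) ∨
    (((∃ d ∈ D, ε / 4 ≤ R d n ω ∨ ε / 4 ≤ Q d n ω) ∨ κ / (2 * ‖d₀‖) ≤ R d₀ n ω) ∨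
      ε / 4 ≤ L n ω)) := by
    simpa [hU] using hnot
  push Not at hU'
  obtain ⟨⟨d, hd, hXd⟩, ⟨hRQ, hR0⟩, hLn⟩ := hU'
  obtain ⟨hRd, hQd⟩ := hRQ d hd
  have hlow : β ≤ lam n ω 1 :=
    (heig n hn1 ω).le_of_norm_apply_sub_lt hd0 hκ hR0
  have hup := (heig n hn1 ω).le_mean_norm_sq
  have hbound := (heig n hn1 ω).norm_sub_pcEstimator_le hΨ (y := fun k => X (k + 1) ω)
    (e := fun k => e k ω) hω hmn (X n ω) (C d) d
  have hn0 : (0 : ℝ) < n := by exact_mod_cast hn1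
  have hterm3 : lam n ω 1 / m n * ‖d‖ ≤ Q d n ω := by
    simp only [hQ]
    rw [div_eq_inv_mul, mul_right_comm]
    gcongr
  have hterm4 : ‖empiricalOperator n (fun k => X k ω) (fun k => e k ω)‖
      * (m n / lam n ω 1 * ‖X n ω‖) ≤ L n ω := by
    set a := ‖∑ k ∈ Finset.Icc 1 n, X k ω ⊗ₜ[ℝ] e k ω‖ with ha
    have hl0 : 0 < lam n ω 1 := hβ0.trans_le hlow
    have hs : 0 < Real.sqrt n := Real.sqrt_pos.2 hn0
    have hss : (n : ℝ) = Real.sqrt n ^ 2 := (Real.sq_sqrt hn0.le).symm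
    calc ‖empiricalOperator n (fun k => X k ω) (fun k => e k ω)‖ * (m n / lam n ω 1 * ‖X n ω‖)
        ≤ ((n : ℝ)⁻¹ * a) * (m n / β * ‖X n ω‖) := by
          gcongr
          exact norm_empiricalOperator_le n (fun k => X k ω) (fun k => e k ω)
      _ = m n / Real.sqrt n * (2 * β)⁻¹ * (2 * ((Real.sqrt n)⁻¹ * a) * ‖X n ω‖) := by
          rw [hss, Real.sqrt_sq hs.le]
          field_simp
      _ ≤ L n ω := by
          simp only [hL]
          gcongr
          have := two_mul_le_add_sq ((Real.sqrt n)⁻¹ * a) ‖X n ω‖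
          have h2 : ((Real.sqrt n)⁻¹ * a) ^ 2 = (n : ℝ)⁻¹ * a ^ 2 := by
            rw [mul_pow, inv_pow, ← hss]
          linarith
  simp only [hR] at hRd
  linarith

end Prediction

/-! ### The causal series and uniqueness of the stationary solution -/

section Autoregression

theorem coupledPast_add {Ω S : Type*} (δ : ℤ → Ω → S) (m : ℕ) (q : Ω × Ω) :
    (fun j => coupledPast δ m q (j + m)) = past δ 0 q.2 := by
  funext j
  simp [coupledPast, past]

variable {H : Type u} [NormedAddCommGroup H] [InnerProductSpace ℝ H]

/-- The causal solution `∑ Ψ^j s_j` of the autoregressive recursion. -/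
def causalSeries (Ψ : H →L[ℝ] H) (s : ℕ → H) : H := ∑' j, (Ψ ^ j) (s j)

theorem causalSeries_eq (Ψ : H →L[ℝ] H) {s : ℕ → H} (m : ℕ)
    (hs : Summable fun j => (Ψ ^ j) (s (j + m))) :
    causalSeries Ψ s = ∑ j ∈ Finset.range m, (Ψ ^ j) (s j)
      + (Ψ ^ m) (causalSeries Ψ fun j => s (j + m)) := by
  have h1 : ∀ j, (Ψ ^ (j + m)) (s (j + m)) = (Ψ ^ m) ((Ψ ^ j) (s (j + m))) := fun j => by
    rw [add_comm, pow_add]; rfl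
  have h2 : Summable fun j => (Ψ ^ j) (s j) := by
    rw [← summable_nat_add_iff m]
    simp only [h1]
    exact hs.mapL (Ψ ^ m)
  rw [causalSeries, ← h2.sum_add_tsum_nat_add m, causalSeries, (Ψ ^ m).map_tsum hs]
  simp only [h1]

theorem norm_pow_apply_le (Ψ : H →L[ℝ] H) (n : ℕ) (x : H) : ‖(Ψ ^ n) x‖ ≤ ‖Ψ‖ ^ n * ‖x‖ := by
  induction n with
  | zero => simp
  | succ n ih =>
    rw [pow_succ', pow_succ', mul_assoc]
    exact (Ψ.le_opNorm _).trans (mul_le_mul_of_nonneg_left ih (norm_nonneg _))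

variable {Ω : Type*} [MeasurableSpace Ω] {P : Measure Ω}

theorem eLpNorm_pow_apply_le (Ψ : H →L[ℝ] H) (n : ℕ) (f : Ω → H) (p : ENNReal) :
    eLpNorm (fun ω => (Ψ ^ n) (f ω)) p P ≤ ‖Ψ‖ₑ ^ n * eLpNorm f p P := by
  have := eLpNorm_le_nnreal_smul_eLpNorm_of_ae_le_mul (μ := P) (f := fun ω => (Ψ ^ n) (f ω))
    (g := f) (c := ‖Ψ‖₊ ^ n) (Eventually.of_forall fun ω => norm_pow_apply_le Ψ n (f ω)) p
  simpa [ENNReal.smul_def, enorm_eq_nnnorm] using this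

theorem tsum_enorm_pow_ne_top {Ψ : H →L[ℝ] H} (hΨ : ‖Ψ‖ < 1) : ∑' n : ℕ, ‖Ψ‖ₑ ^ n ≠ ⊤ := by
  rw [ENNReal.tsum_geometric, Ne, ENNReal.inv_eq_top, tsub_eq_zero_iff_le, not_le]
  rw [← ofReal_norm]
  exact ENNReal.ofReal_lt_one.2 hΨ

variable [MeasurableSpace H] [BorelSpace H]

variable {δ : ℤ → Ω → H} {Ψ : H →L[ℝ] H}

theorem IsIID.tsum_eLpNorm_ne_top (h : IsIID P δ) (hΨ : ‖Ψ‖ < 1) {p : ENNReal}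
    (hδ : MemLp (δ 0) p P) (k : ℤ) :
    ∑' j, eLpNorm (fun ω => (Ψ ^ j) (past δ k ω j)) p P ≠ ⊤ := by
  refine ne_top_of_le_ne_top ?_ (ENNReal.tsum_le_tsum fun j =>
    eLpNorm_pow_apply_le Ψ j (fun ω => past δ k ω j) p)
  have : ∀ j, eLpNorm (fun ω => past δ k ω j) p P = eLpNorm (δ 0) p P := fun j =>
    (h.identDistrib (k - j)).eLpNorm_eq p
  simp only [this]
  rw [ENNReal.tsum_mul_right]
  exact ENNReal.mul_ne_top (tsum_enorm_pow_ne_top hΨ) hδ.2.ne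

variable [SecondCountableTopology H] [CompleteSpace H]

theorem measurable_causalSeries (Ψ : H →L[ℝ] H) : Measurable (causalSeries Ψ) :=
  Measurable.tsum fun j => (Ψ ^ j).continuous.measurable.comp (measurable_pi_apply j)

theorem IsIID.ae_summable_causalSeries (h : IsIID P δ) (hΨ : ‖Ψ‖ < 1) {p : ENNReal} (hp : 1 ≤ p)
    (hδ : MemLp (δ 0) p P) (k : ℤ) :
    ∀ᵐ ω ∂P, Summable fun j => (Ψ ^ j) (past δ k ω j) := by
  filter_upwards [summable_norm_of_tsum_eLpNorm_ne_top hp (fun j =>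
    ((Ψ ^ j).continuous.measurable.comp (h.measurable _)).aestronglyMeasurable)
    (h.tsum_eLpNorm_ne_top hΨ hδ k)] with ω hω
  exact hω.of_norm

theorem IsIID.memLp_causalSeries (h : IsIID P δ) (hΨ : ‖Ψ‖ < 1) {p : ENNReal} (hp : 1 ≤ p)
    (hδ : MemLp (δ 0) p P) (k : ℤ) : MemLp (fun ω => causalSeries Ψ (past δ k ω)) p P := by
  refine ⟨((measurable_causalSeries Ψ).comp
    (measurable_past h.measurable k)).aestronglyMeasurable, ?_⟩
  have hm : ∀ j, AEStronglyMeasurable (fun ω => (Ψ ^ j) (past δ k ω j)) P := fun j =>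
    ((Ψ ^ j).continuous.measurable.comp (h.measurable _)).aestronglyMeasurable
  refine lt_of_le_of_lt ?_ (h.tsum_eLpNorm_ne_top hΨ hδ k).lt_top
  refine Lp.eLpNorm_le_of_ae_tendsto (u := atTop)
    (f := fun n => ∑ j ∈ Finset.range n, fun ω => (Ψ ^ j) (past δ k ω j))
    (Eventually.of_forall fun n => ?_)
    (fun n => Finset.aestronglyMeasurable_sum _ fun j _ => hm j) ?_
  · exact (eLpNorm_sum_le (fun j _ => hm j) hp).trans (ENNReal.sum_le_tsum _)
  · filter_upwards [h.ae_summable_causalSeries hΨ hp hδ k] with ω hω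
    simpa only [Finset.sum_apply, causalSeries] using hω.hasSum.tendsto_sum_nat

variable [IsProbabilityMeasure P]

/-- The coupling error of a causal autoregression decays geometrically. -/
theorem IsIID.couplingError_causalSeries_le (h : IsIID P δ) (hΨ : ‖Ψ‖ < 1) {p : ENNReal}
    (hp : 1 ≤ p) (hδ : MemLp (δ 0) p P) (m : ℕ) :
    couplingError P p δ (causalSeries Ψ) m
      ≤ ‖Ψ‖ₑ ^ m * (2 * eLpNorm (fun ω => causalSeries Ψ (past δ 0 ω)) p P) := by
  have hs := h.ae_summable_causalSeries hΨ hp hδ 0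
  have hmem := h.memLp_causalSeries hΨ hp hδ 0
  have hfst : ∀ᵐ q ∂(P.prod P), Summable fun j => (Ψ ^ j) (past δ 0 q.1 j) :=
    Measure.quasiMeasurePreserving_fst.ae hs
  have hsnd : ∀ᵐ q ∂(P.prod P), Summable fun j => (Ψ ^ j) (past δ 0 q.2 j) :=
    Measure.quasiMeasurePreserving_snd.ae hs
  rw [couplingError_eq]
  -- The first `m` terms of the two series agree and cancel; what remains is `Ψ^m` of a difference
  -- of two independent copies.
  have hae : (fun q : Ω × Ω => causalSeries Ψ (past δ m q.1) - causalSeries Ψ (coupledPast δ m q))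
      =ᵐ[P.prod P] fun q => (Ψ ^ m) (causalSeries Ψ (past δ 0 q.1)
        - causalSeries Ψ (past δ 0 q.2)) := by
    filter_upwards [hfst, hsnd] with q h1 h2
    have e1 : (fun j => past δ m q.1 (j + m)) = past δ 0 q.1 := by
      rw [past_eq_shift δ 0 m, zero_add]
    have e2 := coupledPast_add δ m q
    rw [causalSeries_eq Ψ m (s := past δ m q.1)
        (by simpa only [← e1] using h1),
      causalSeries_eq Ψ m (s := coupledPast δ m q) (by simpa only [← e2] using h2), e1, e2, map_sub]
    have e3 : ∑ j ∈ Finset.range m, (Ψ ^ j) (coupledPast δ m q j)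
        = ∑ j ∈ Finset.range m, (Ψ ^ j) (past δ m q.1 j) :=
      Finset.sum_congr rfl fun j hj => by
        simp [coupledPast, past, Finset.mem_range.1 hj]
    rw [e3, add_sub_add_left_eq_sub]
  rw [eLpNorm_congr_ae hae]
  refine (eLpNorm_pow_apply_le Ψ m _ p).trans ?_
  gcongr
  refine (eLpNorm_sub_le (hmem.comp_fst P).1 (hmem.comp_snd P).1 hp).trans_eq ?_
  rw [two_mul]
  exact congrArg₂ (· + ·)
    (eLpNorm_comp_measurePreserving (g := fun ω => causalSeries Ψ (past δ 0 ω)) (f := Prod.fst)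
      hmem.1 measurePreserving_fst)
    (eLpNorm_comp_measurePreserving (g := fun ω => causalSeries Ψ (past δ 0 ω)) (f := Prod.snd)
      hmem.1 measurePreserving_snd)

theorem IsIID.tsum_couplingError_causalSeries_ne_top (h : IsIID P δ) (hΨ : ‖Ψ‖ < 1) {p : ENNReal}
    (hp : 1 ≤ p) (hδ : MemLp (δ 0) p P) :
    ∑' m : ℕ, couplingError P p δ (causalSeries Ψ) (m + 1) ≠ ⊤ := by
  refine ne_top_of_le_ne_top ?_ (ENNReal.tsum_le_tsum fun m =>
    h.couplingError_causalSeries_le hΨ hp hδ (m + 1))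
  rw [ENNReal.tsum_mul_right]
  refine ENNReal.mul_ne_top (ne_top_of_le_ne_top (tsum_enorm_pow_ne_top hΨ)
    (ENNReal.tsum_comp_le_tsum_of_injective (add_left_injective 1) _))
    (ENNReal.mul_ne_top (by simp) (h.memLp_causalSeries hΨ hp hδ 0).2.ne)

/-- Here `Z` is fixed and needs no moments. The probability depends only on its law, so the limit
transfers to a time-dependent variable of constant law. -/
theorem ae_tendsto_measure_pow_mul_ge {Z : Ω → ℝ} (hZ : AEMeasurable Z P) {r : ℝ} (hr : 0 ≤ r)
    (hr1 : r < 1) {ρ : ℝ} (hρ : 0 < ρ) :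
    Tendsto (fun n : ℕ => P {ω | ρ ≤ ‖r ^ n * Z ω‖}) atTop (𝓝 0) := by
  have h1 : TendstoInMeasure P (fun (n : ℕ) ω => r ^ n * Z ω) atTop (fun _ => (0 : ℝ)) :=
    tendstoInMeasure_of_tendsto_ae (fun n => (hZ.const_mul _).aestronglyMeasurable)
      (ae_of_all _ fun ω => by
        simpa using (tendsto_pow_atTop_nhds_zero_of_lt_one hr hr1).mul_const (Z ω))
  rw [tendstoInMeasure_iff_norm] at h1
  simpa using h1 ρ hρ

/-- A stationary solution of the autoregressive recursion is the causal one. -/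
theorem IsIID.ae_eq_causalSeries (h : IsIID P δ) (hΨ : ‖Ψ‖ < 1) {p : ENNReal}
    (hp : 1 ≤ p) (hδ : MemLp (δ 0) p P) {X : ℤ → Ω → H}
    (hX : ∀ k, IdentDistrib (X k) (X 0) P P)
    (hrec : ∀ k, ∀ᵐ ω ∂P, X (k + 1) ω = Ψ (X k ω) + δ (k + 1) ω) (k : ℤ) :
    X k =ᵐ[P] fun ω => causalSeries Ψ (past δ k ω) := by
  set Y : ℤ → Ω → H := fun k ω => causalSeries Ψ (past δ k ω) with hY
  have hYrec : ∀ k, ∀ᵐ ω ∂P, Y (k + 1) ω = Ψ (Y k ω) + δ (k + 1) ω := fun k => by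
    filter_upwards [h.ae_summable_causalSeries hΨ hp hδ k] with ω hω
    have e1 := past_tail δ k ω
    simp only [hY]
    rw [causalSeries_eq Ψ 1 (s := past δ (k + 1) ω) (by simpa only [← e1] using hω), e1]
    simp [past, add_comm]
  have hpow : ∀ n : ℕ, ∀ k, ∀ᵐ ω ∂P,
      X k ω - Y k ω = (Ψ ^ n) (X (k - n) ω - Y (k - n) ω) := fun n => by
    induction n with
    | zero => intro k; simp
    | succ n ih =>
      intro k
      filter_upwards [ih k, hrec (k - (n + 1 : ℕ)), hYrec (k - (n + 1 : ℕ))] with ω h1 h2 h3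
      have hk : k - ((n + 1 : ℕ) : ℤ) + 1 = k - n := by push_cast; ring
      rw [hk] at h2 h3
      rw [h1, h2, h3, add_sub_add_right_eq_sub, ← map_sub, pow_succ]
      rfl
  have hXm : ∀ k, IdentDistrib (fun ω => ‖X k ω‖) (fun ω => ‖X 0 ω‖) P P := fun k => (hX k).norm
  have hYm : ∀ k, IdentDistrib (fun ω => ‖Y k ω‖) (fun ω => ‖Y 0 ω‖) P P := fun k =>
    ((h.identDistrib_past k 0).comp (measurable_causalSeries Ψ)).norm
  -- The event does not depend on `n`, yet its probability is bounded by quantities tending to zero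
  -- as the recursion is iterated `n` times.
  have hzero : ∀ ρ : ℝ, 0 < ρ → P {ω | ρ ≤ ‖X k ω - Y k ω‖} = 0 := fun ρ hρ => by
    have hlim := (ae_tendsto_measure_pow_mul_ge (hXm 0).aemeasurable_fst (norm_nonneg Ψ) hΨ
      (half_pos hρ)).add (ae_tendsto_measure_pow_mul_ge (hYm 0).aemeasurable_fst (norm_nonneg Ψ) hΨ
      (half_pos hρ))
    rw [add_zero] at hlim
    refine le_antisymm (ge_of_tendsto hlim (Eventually.of_forall fun n => ?_)) zero_le
    have hset : MeasurableSet {x : ℝ | ρ / 2 ≤ ‖‖Ψ‖ ^ n * x‖} :=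
      (isClosed_le continuous_const (by fun_prop)).measurableSet
    have e1 := (hXm (k - n)).measure_mem_eq hset
    have e2 := (hYm (k - n)).measure_mem_eq hset
    refine le_trans (measure_mono_ae (t := (fun ω => ‖X (k - n) ω‖) ⁻¹'
      {x : ℝ | ρ / 2 ≤ ‖‖Ψ‖ ^ n * x‖} ∪ (fun ω => ‖Y (k - n) ω‖) ⁻¹'
      {x : ℝ | ρ / 2 ≤ ‖‖Ψ‖ ^ n * x‖}) ?_) ((measure_union_le _ _).trans (add_le_add e1.le e2.le))
    filter_upwards [hpow n k] with ω hω hbad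
    have hbad' : ρ ≤ ‖X k ω - Y k ω‖ := hbad
    rw [hω] at hbad'
    have h1 := norm_pow_apply_le Ψ n (X (k - n) ω - Y (k - n) ω)
    have h2 := norm_sub_le (X (k - n) ω) (Y (k - n) ω)
    have h3 : (0 : ℝ) ≤ ‖Ψ‖ ^ n := by positivity
    change ρ / 2 ≤ ‖‖Ψ‖ ^ n * ‖X (k - n) ω‖‖ ∨ ρ / 2 ≤ ‖‖Ψ‖ ^ n * ‖Y (k - n) ω‖‖
    rw [norm_mul, norm_mul, norm_norm, norm_norm, norm_pow, norm_norm]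
    by_contra hcon
    push Not at hcon
    nlinarith [mul_le_mul_of_nonneg_left h2 h3]
  have hall : ∀ᵐ ω ∂P, ∀ n : ℕ, ‖X k ω - Y k ω‖ < 1 / ((n : ℝ) + 1) := ae_all_iff.2 fun n => by
    rw [ae_iff]
    simpa only [not_lt] using hzero (1 / ((n : ℝ) + 1)) (by positivity)
  filter_upwards [hall] with ω hω
  refine sub_eq_zero.1 (norm_eq_zero.1 (le_antisymm ?_ (norm_nonneg _)))
  exact ge_of_tendsto tendsto_one_div_add_atTop_nhds_zero_nat
    (Eventually.of_forall fun n => (hω n).le)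

end Autoregression

/-! ### Assumption (A) for stationary autoregressions -/

section StationaryAutoregression

/-- In law the past at `k + 1` is `coupledPast δ 1`, whose head and tail live on different factors
of the product space. -/
theorem IsIID.integral_past_mul_next {Ω : Type*} [MeasurableSpace Ω] {P : Measure Ω}
    [IsProbabilityMeasure P] {S : Type*} [MeasurableSpace S] {δ : ℤ → Ω → S} (h : IsIID P δ)
    {u : (ℕ → S) → ℝ} {w : S → ℝ} (hu : Measurable u) (hw : Measurable w) (k : ℤ) :
    ∫ ω, u (past δ k ω) * w (δ (k + 1) ω) ∂P
      = (∫ ω, w (δ 1 ω) ∂P) * ∫ ω, u (past δ 0 ω) ∂P := by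
  have hG : Measurable fun s : ℕ → S => u (fun j => s (j + 1)) * w (s 0) := by fun_prop
  have h1 := ((h.identDistrib_past (k + 1) 0).comp hG).integral_eq
  have h2 := ((h.identDistrib_coupledPast 1).comp hG).integral_eq
  rw [← h2] at h1
  simp only [Function.comp_def, past_tail] at h1
  rw [← integral_prod_mul]
  calc _ = _ := integral_congr_ae (Eventually.of_forall fun ω => by simp [past])
    _ = _ := h1
    _ = _ := integral_congr_ae (Eventually.of_forall fun q => by
      have : (fun j => coupledPast δ 1 q (j + 1)) = past δ 0 q.2 := coupledPast_add δ 1 q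
      simp only [this]
      simp [coupledPast, mul_comm])

theorem IsStationaryARH1.identDistrib {H : Type u} [NormedAddCommGroup H]
    [InnerProductSpace ℝ H] [MeasurableSpace H] {Ω : Type*} [MeasurableSpace Ω] {P : Measure Ω} {Ψ : H →L[ℝ] H} {X ε : ℤ → Ω → H}
    (hX : IsStationaryARH1 P Ψ X ε) (k : ℤ) : IdentDistrib (X k) (X 0) P P where
  aemeasurable_fst := hX.aemeasurable k
  aemeasurable_snd := hX.aemeasurable 0
  map_eq := by
    have h1 := congrArg (Measure.map fun s : ℤ → H => s 0) (hX.stationary k)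
    rw [AEMeasurable.map_map_of_aemeasurable (measurable_pi_apply 0).aemeasurable
        (aemeasurable_pi_iff.2 fun j => hX.aemeasurable _),
      AEMeasurable.map_map_of_aemeasurable (measurable_pi_apply 0).aemeasurable
        (aemeasurable_pi_iff.2 fun j => hX.aemeasurable _)] at h1
    simpa [Function.comp_def] using h1

/-- The representing function reads only the newest innovation, so all coupling errors with index at
least `1` vanish. -/
theorem isLpMApproximable_of_iid {H : Type u} [NormedAddCommGroup H]
    [MeasurableSpace H] {Ω : Type*} [MeasurableSpace Ω] {P : Measure Ω} {δ : ℤ → Ω → H} (h : IsIID P δ) {p : ENNReal}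
    {e : ℕ → Ω → H} (hp : ∀ n, MemLp (e n) p P) (he : ∀ n : ℕ, e n =ᵐ[P] δ (n + 1)) :
    IsLpMApproximable P p e := by
  refine ⟨fun n _ => hp n, H, inferInstance, fun i => δ (i + 1), fun s => s 0,
    fun i => h.measurable _, h.indep.precomp (add_left_injective 1),
    fun i => (h.identDistrib _).trans (h.identDistrib _).symm, measurable_pi_apply 0,
    fun n _ => ?_, ?_⟩
  · simpa using he n
  · simp [couplingError]

variable {H : Type u} [NormedAddCommGroup H] [InnerProductSpace ℝ H] [CompleteSpace H]
  {Ω : Type*} [MeasurableSpace Ω] {P : Measure Ω}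

theorem orthogonal_of_integral_eq_zero {X Y : Ω → H} (hX : MemLp X 2 P) (hY : MemLp Y 2 P)
    (h : ∀ x y, ∫ ω, inner ℝ x (X ω) * inner ℝ y (Y ω) ∂P = 0) : Orthogonal P X Y := by
  refine ⟨hX, hY, ?_⟩
  ext x
  refine ext_inner_left ℝ fun y => ?_
  rw [inner_integral_tensor hX hY, h, _root_.zero_apply, inner_zero_right]

variable [MeasurableSpace H] [BorelSpace H] [IsProbabilityMeasure P]

theorem isWhiteNoise_of_iIndepFun {e : ℕ → Ω → H} (hi : iIndepFun e P)
    (hd : ∀ k, IdentDistrib (e k) (e 0) P P) (h2 : ∀ k, MemLp (e k) 2 P)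
    (h0 : ∀ k, ∫ ω, e k ω ∂P = 0) : IsWhiteNoise P e where
  memLp k _ := h2 k
  orthogonal j k _ _ hjk := by
    refine orthogonal_of_integral_eq_zero (h2 j) (h2 k) fun x y => ?_
    have hmx : ∀ z : H, Measurable fun x : H => inner ℝ z x := fun z =>
      (continuous_const.inner continuous_id).measurable
    have hind := (hi.indepFun hjk).comp (hmx x) (hmx y)
    have := hind.integral_fun_mul_eq_mul_integral ((h2 j).const_inner x).1
      ((h2 k).const_inner y).1
    simp only [Function.comp_def] at this
    rw [this, integral_inner ((h2 j).integrable (by norm_num)), h0, inner_zero_right, zero_mul]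
  mean_const j k _ _ := by rw [h0, h0]
  cov_const j k _ _ := by
    simp only [covOperator, h0, sub_zero]
    ext x
    refine ext_inner_left ℝ fun y => ?_
    rw [inner_integral_tensor (h2 j) (h2 j), inner_integral_tensor (h2 k) (h2 k)]
    have hm : Measurable fun z : H => inner ℝ x z * inner ℝ y z := by
      have : Continuous fun z : H => inner ℝ x z * inner ℝ y z := by fun_prop
      exact this.measurable
    exact (((hd j).trans (hd k).symm).comp hm).integral_eq

variable [SecondCountableTopology H]

theorem IsStationaryARH1.assumptionA {Ψ : H →L[ℝ] H} (hΨ : ‖Ψ‖ < 1) {X ε : ℤ → Ω → H}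
    (hX : IsStationaryARH1 P Ψ X ε) (hi : iIndepFun ε P)
    (hd : ∀ i, IdentDistrib (ε i) (ε 0) P P) (h4 : ∀ i, MemLp (ε i) 4 P)
    (h0 : ∀ i, ∫ ω, ε i ω ∂P = 0) :
    AssumptionA P (fun k : ℕ => X k) (fun k : ℕ => ε ((k : ℤ) + 1)) := by
  have hεm : ∀ i, AEMeasurable (ε i) P := fun i => (h4 i).1.aemeasurable
  -- Approximability asks for a measurable driving sequence, while the innovations are only almost
  -- everywhere measurable.
  set δ : ℤ → Ω → H := fun i => (hεm i).mk with hδ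
  have hεδ : ∀ i, ε i =ᵐ[P] δ i := fun i => (hεm i).ae_eq_mk
  have h : IsIID P δ := ⟨fun i => (hεm i).measurable_mk, hi.congr hεδ, fun i =>
    ((IdentDistrib.of_ae_eq (hεm i) (hεδ i)).symm.trans (hd i)).trans
      (IdentDistrib.of_ae_eq (hεm 0) (hεδ 0))⟩
  have hδ4 : MemLp (δ 0) 4 P := (memLp_congr_ae (hεδ 0)).1 (h4 0)
  have hrec : ∀ k, ∀ᵐ ω ∂P, X (k + 1) ω = Ψ (X k ω) + δ (k + 1) ω := fun k => by
    filter_upwards [hX.recurrence k, hεδ (k + 1)] with ω h1 h2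
    rw [h1, h2]
  have hXf := h.ae_eq_causalSeries hΨ (by norm_num) hδ4 hX.identDistrib hrec
  have hX4 : ∀ k, MemLp (X k) 4 P := fun k =>
    (memLp_congr_ae (hXf k)).2 (h.memLp_causalSeries hΨ (by norm_num) hδ4 k)
  have h42 : ∀ {f : Ω → H}, MemLp f 4 P → MemLp f 2 P := fun hf => hf.mono_exponent (by norm_num)
  have hε2 : ∀ i, MemLp (ε i) 2 P := fun i => h42 (h4 i)
  have hX1 : ∀ k, Integrable (X k) P := fun k => (hX4 k).integrable (by norm_num)
  have hmean : ∫ ω, X 0 ω ∂P = 0 := by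
    -- The mean is a fixed point of a strict linear contraction, hence zero.
    have h1 : ∫ ω, X 0 ω ∂P = Ψ (∫ ω, X 0 ω ∂P) := by
      rw [← Ψ.integral_comp_comm (hX1 0), ← (hX.identDistrib (0 + 1)).integral_eq,
        integral_congr_ae (hX.recurrence 0),
        integral_add (Ψ.integrable_comp (hX1 0)) ((h4 _).integrable (by norm_num)), h0, add_zero]
    by_contra hne
    have h2 := Ψ.le_opNorm (∫ ω, X 0 ω ∂P)
    rw [← h1] at h2
    have h3 := norm_pos_iff.2 hne
    nlinarith
  exact
    { mean_X := fun k _ => (hX.identDistrib k).integral_eq.trans hmean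
      mean_ε := fun k _ => h0 _
      approx_X := ⟨fun n _ => hX4 n, H, inferInstance, δ, causalSeries Ψ, h.measurable, h.indep,
        h.identDistrib, measurable_causalSeries Ψ, fun n _ => hXf n,
        h.tsum_couplingError_causalSeries_ne_top hΨ (by norm_num) hδ4⟩
      approx_ε := isLpMApproximable_of_iid h (fun n => h4 _) fun n => hεδ _
      whiteNoise := isWhiteNoise_of_iIndepFun (hi.precomp fun a b hab => by simpa using hab)
        (fun k => (hd _).trans (hd _).symm) (fun k => hε2 _) fun k => h0 _
      orthogonal := fun k _ => by
        refine orthogonal_of_integral_eq_zero (h42 (hX4 k)) (hε2 _) fun x y => ?_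
        have hmx : ∀ z : H, Measurable fun x : H => inner ℝ z x := fun z =>
          (continuous_const.inner continuous_id).measurable
        have h1 := h.integral_past_mul_next ((hmx x).comp (measurable_causalSeries Ψ)) (hmx y) k
        have h2 : ∫ ω, inner ℝ y (δ 1 ω) ∂P = 0 := by
          rw [integral_inner (((memLp_congr_ae (hεδ 1)).1 (h4 1)).integrable (by norm_num)),
            ← integral_congr_ae (hεδ 1), h0, inner_zero_right]
        rw [h2, zero_mul] at h1
        rw [← h1]
        refine integral_congr_ae ?_
        filter_upwards [hXf k, hεδ (k + 1)] with ω e1 e2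
        simp only [e1, e2, Function.comp_def] }

end StationaryAutoregression

end FunctionalRegression

end

theorem corollary1
    {Ω : Type*} [MeasurableSpace Ω] (P : Measure Ω) [IsProbabilityMeasure P]
    {H : Type*} [NormedAddCommGroup H] [InnerProductSpace ℝ H] [CompleteSpace H]
    [TopologicalSpace.SeparableSpace H] [MeasurableSpace H] [BorelSpace H]
    (Ψ : H →L[ℝ] H) (hΨ : ‖Ψ‖ < 1) :
    -- Prediction: the regression errors are `ε (k + 1)` and the responses are `X (k + 1)`, `k ≥ 1`.
    (∀ X ε : ℕ → Ω → H,
      (∀ n, 1 ≤ n → ∀ᵐ ω ∂P, X (n + 1) ω = Ψ (X n ω) + ε (n + 1) ω) →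
      FunctionalRegression.AssumptionA P X (fun k => ε (k + 1)) →
      ∀ m : ℕ → ℝ, Tendsto m atTop atTop →
      m =o[atTop] (fun n : ℕ => Real.sqrt n) →
      ∀ (lam : ℕ → Ω → ℕ → ℝ) (v : ℕ → Ω → ℕ → H),
      (∀ n, 1 ≤ n → ∀ ω, FunctionalRegression.IsEigensystem
        (FunctionalRegression.empiricalOperator n (fun k => X k ω) (fun k => X k ω))
        (lam n ω) (v n ω)) →
      TendstoInMeasure P
        (fun n ω => ‖Ψ (X n ω) -
          FunctionalRegression.pcEstimator n
            (FunctionalRegression.truncationLevel n (m n) (lam n ω))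
            (fun k => X k ω) (fun k => X (k + 1) ω) (lam n ω) (v n ω) (X n ω)‖)
        atTop (fun _ => (0 : ℝ))) ∧
    -- Centred i.i.d. innovations with four moments: Assumption (A) holds.
    (∀ X ε : ℤ → Ω → H,
      FunctionalRegression.IsStationaryARH1 P Ψ X ε →
      iIndepFun ε P → (∀ i, IdentDistrib (ε i) (ε 0) P P) →
      (∀ i, MemLp (ε i) 4 P) → (∀ i, ∫ ω, ε i ω ∂P = 0) →
      FunctionalRegression.AssumptionA P
        (fun k : ℕ => X k) (fun k : ℕ => ε ((k : ℤ) + 1))) := by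
  have := UniformSpace.secondCountable_of_separable H
  refine ⟨fun X ε hrec hA m hm hmo lam v heig => ?_, fun X ε hX hi hd h4 h0 =>
    hX.assumptionA hΨ hi hd h4 h0⟩
  exact FunctionalRegression.tendstoInMeasure_prediction Ψ hΨ.le hrec hA.approx_X
    (hA.orthogonal 1 le_rfl) hm hmo heig
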